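/- For $n\ge 1$ let $V=[n]$, let $E_n$ be the set of edges of the complete graph $K_n$ on $V$ and $N=\binom n2=|E_n|$. For $\alpha=(\alpha_e)_{e\in E_n}$ with all $\alpha_e>0$ let $X=(X_e)_{e\in E_n}$ be chosen uniformly at random from the simplex $\Sigma_{n,\alpha}=\{X\in\mathbb R_+^{N}:\sum_{e\in E_n}\alpha_eX_e\le N\}$, and let $\Lambda_X$ be the minimum weight of a spanning tree of $K_n$ when the edge $e$ has weight $X_e$. Put $\omega=\omega(n)=(\ln n)^{1/10}$. Suppose that for all sufficiently large $n$, $\alpha=\alpha^{(n)}$ is decomposable, $\alpha_{vw}=d_vd_w$ for all $v\ne w$, with $d_v=d^{(n)}_v\in[\omega^{-1},\omega]$ for all $v\in V$. Write $d_S=\sum_{v\in S}d_v$ for $S\subseteq V$ and $D=d_V$. Then, as $n\to\infty$, $$\mathsf E[\Lambda_X]\sim\sum_{k=1}^{\infty}\frac{(k-1)!}{D^k}\sum_{\substack{S\subseteq V\\|S|=k}}\frac{\prod_{v\in S}d_v}{d_S^2},$$ where $a_n\sim b_n$ means $\lim_{n\to\infty}a_n/b_n=1$. In particular, if $d_v=1$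 for all $v\in V$ (so that $\alpha_e=1$ for all $e$), then the right-hand side converges to $\zeta(3)$ as $n\to\infty$, and $\mathsf E[\Lambda_X]\to\zeta(3)$. -/

import Mathlib

open Filter Topology MeasureTheory
open scoped Nat

/-- The edge set `E_n` of the complete graph on the vertex set `Fin n`; the coordinates of
`ℝ^N`, `N = n.choose 2`, are indexed by it. -/
abbrev KEdge (n : ℕ) : Type := (⊤ : SimpleGraph (Fin n)).edgeSet

/-- The edge `vw` of the complete graph. -/
def kedge {n : ℕ} (v w : Fin n) (h : v ≠ w) : KEdge n :=
  ⟨s(v, w), by simpa using h⟩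

/-- The simplex of all `X ∈ ℝ_+^N` with `∑_e α_e X_e ≤ L`. -/
def weightSimplex (n : ℕ) (L : ℝ) (α : KEdge n → ℝ) : Set (KEdge n → ℝ) :=
  {X | (∀ e, 0 ≤ X e) ∧ ∑ e, α e * X e ≤ L}

/-- The uniform distribution on the simplex with bound `L = N = n.choose 2`, i.e. normalized
Lebesgue measure on it. -/
noncomputable def simplexLaw (n : ℕ) (α : KEdge n → ℝ) : Measure (KEdge n → ℝ) :=
  ProbabilityTheory.cond volume (weightSimplex n (n.choose 2 : ℝ) α)

open Classical in
/-- The total weight `∑_{e ∈ T} X_e` of a graph `T` on `Fin n` under the edge weights `X`. -/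
noncomputable def graphWeight {n : ℕ} (X : KEdge n → ℝ) (T : SimpleGraph (Fin n)) : ℝ :=
  ∑ e : KEdge n, if (e : Sym2 (Fin n)) ∈ T.edgeSet then X e else 0

/-- `Λ_X`: the minimum weight of a spanning tree of the complete graph with edge weights `X`. -/
noncomputable def mstWeight {n : ℕ} (X : KEdge n → ℝ) : ℝ :=
  ⨅ T : {T : SimpleGraph (Fin n) // T.IsTree}, graphWeight X T.1

/-- `E[Λ_X]` for `X` uniform on the simplex. -/
noncomputable def expectedMST (n : ℕ) (α : KEdge n → ℝ) : ℝ :=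
  ∫ X, mstWeight X ∂(simplexLaw n α)

/-- `α` is decomposable with factors `d`: `α_vw = d_v d_w` for all `v ≠ w`. -/
def IsDecomposition {n : ℕ} (α : KEdge n → ℝ) (d : Fin n → ℝ) : Prop :=
  ∀ (v w : Fin n) (h : v ≠ w), α (kedge v w h) = d v * d w

/-- `∑_{k ≥ 1} (k-1)!/D^k ∑_{|S| = k} (∏_{v ∈ S} d_v) / d_S^2`, where `d_S = ∑_{v ∈ S} d_v` and
`D` is the sum of all `d_v`; the summation index below is `k - 1`, and the terms with `k > n`
vanish. -/
noncomputable def mstSeries {n : ℕ} (d : Fin n → ℝ) : ℝ :=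
  ∑' k : ℕ, (k ! : ℝ) / (∑ v, d v) ^ (k + 1) *
    ∑ S ∈ Finset.powersetCard (k + 1) (Finset.univ : Finset (Fin n)),
      (∏ v ∈ S, d v) / (∑ v ∈ S, d v) ^ 2

/-!
Why the theorem holds.

*From the simplex to independent weights.* `Λ` is homogeneous of degree one, and the density
`∏ α_e e^{-α_e x_e}` is a mixture of uniform densities on the simplices `∑ α_e x_e ≤ t`. Hence
`E[Λ]` for the simplex is exactly `N / (N + 1)` times `E[Λ]` for independent exponential weights
with rates `α_e` (`expectedMST_eq`).

*From the tree to components.* Let `κ(t)` be the number of components of the graph of the edges of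
weight at most `t`. Then `Λ = ∫ (κ(t) - 1) dt` over `t > 0` (`ofReal_mstWeight`): a spanning tree
has at least `κ(t) - 1` edges above `t`, and Kruskal's tree has exactly that many, for every `t`.

*The probability of a component.* Let `d_C` be the sum of `d` over `C`. Exploring the graph from a
set `R` one vertex at a time, the probability that all of `S` is reached satisfies a recursion over
the neighbourhood of the explored vertex. The recursion with `1 - e^{-x}` replaced by `x` is solved
by the closed form `reachWeight`, thanks to an Abel-type identity, and `x e^{-x} ≤ 1 - e^{-x} ≤ x`
turns this into two-sided bounds (`reachProb_bounds`). So the rank-one form of `α` replaces any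
enumeration of trees. With the independent event that no edge leaves `C`, the probability that `C`
is a component at time `t` is `∏_{v ∈ C} d_v · d_C ^ (k - 2) · t ^ (k - 1) · e^{-t d_C D}`,
`k = |C|`, up to a factor between `1` and `e^{t d_C²}` (`component_bounds`). The integral of this
expression over `t > 0` is the term of `C` in the series.

*Error terms.* Take `T = 4 ω² log n / n` and consider components with at most `K = log⁶ n`
vertices. For these and `t ≤ T` the factor `e^{t d_C²}` tends to one uniformly. The larger
components number at most `n / K`, which contributes at most `T n / K`. After time `T` the graph is
connected up to a negligible probability, by a union bound over the sets of at most `n / 2`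
vertices. The terms of the series with `|C| > K` sum to `O(ω² / K)`. All of these are small against
the series, which is at least `ω⁻²`, so that the crude bound `ω ≤ log n` suffices.

For `d = 1` the terms of the series converge to `1 / k³` under the bound `1 / k³`, which gives
`ζ(3)` by dominated convergence.
-/

/-! ### Forests and numbers of components -/

section Forest

variable {V : Type*}

/-- Adding an edge `uv` to a graph creates only those new connections that pass through `uv`. -/
lemma reachable_sup_edge_cases {G : SimpleGraph V} {u v a b : V}
    (h : (G ⊔ SimpleGraph.edge u v).Reachable a b) :
    G.Reachable a b ∨ (G.Reachable a u ∧ G.Reachable v b) ∨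
      (G.Reachable a v ∧ G.Reachable u b) := by
  obtain ⟨p⟩ := h
  induction p with
  | nil => exact Or.inl (SimpleGraph.Reachable.refl _)
  | @cons a c b hac p ih =>
    rw [SimpleGraph.sup_adj, SimpleGraph.edge_adj] at hac
    rcases hac with hac | ⟨⟨rfl, rfl⟩ | ⟨rfl, rfl⟩, -⟩
    · have := hac.reachable
      rcases ih with ih | ⟨h1, h2⟩ | ⟨h1, h2⟩
      · exact Or.inl (this.trans ih)
      · exact Or.inr (Or.inl ⟨this.trans h1, h2⟩)
      · exact Or.inr (Or.inr ⟨this.trans h1, h2⟩)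
    · rcases ih with ih | ⟨h1, h2⟩ | ⟨h1, h2⟩
      · exact Or.inr (Or.inl ⟨.refl _, ih⟩)
      · exact Or.inr (Or.inl ⟨.refl _, h2⟩)
      · exact Or.inl h2
    · rcases ih with ih | ⟨h1, h2⟩ | ⟨h1, h2⟩
      · exact Or.inr (Or.inr ⟨.refl _, ih⟩)
      · exact Or.inl h2
      · exact Or.inr (Or.inr ⟨.refl _, h2⟩)

/-- Joining two components by an edge lowers the number of components by one. -/
lemma card_connectedComponent_sup_edge [Finite V] {G : SimpleGraph V} {u v : V}
    (huv : ¬ G.Reachable u v) :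
    Nat.card (G ⊔ SimpleGraph.edge u v).ConnectedComponent + 1 =
      Nat.card G.ConnectedComponent := by
  classical
  set G' := G ⊔ SimpleGraph.edge u v with hG'
  have hle : G ≤ G' := le_sup_left
  have hadj : G'.Adj u v := by
    rw [hG', SimpleGraph.sup_adj, SimpleGraph.edge_adj]
    exact Or.inr ⟨Or.inl ⟨rfl, rfl⟩, fun h => huv (h ▸ .refl _)⟩
  let f : {c : G.ConnectedComponent // c ≠ G.connectedComponentMk u} → G'.ConnectedComponent :=
    fun c => c.1.map (SimpleGraph.Hom.ofLE hle)
  have hf : Function.Bijective f := by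
    constructor
    · rintro ⟨c, hc⟩ ⟨c', hc'⟩ hcc
      induction c using SimpleGraph.ConnectedComponent.ind with | _ a
      induction c' using SimpleGraph.ConnectedComponent.ind with | _ b
      simp only [f, SimpleGraph.ConnectedComponent.map_mk, SimpleGraph.Hom.coe_ofLE, id,
        SimpleGraph.ConnectedComponent.eq, ne_eq, Subtype.mk.injEq] at hcc hc hc' ⊢
      rcases reachable_sup_edge_cases hcc with h | ⟨h, -⟩ | ⟨-, h⟩
      · exact h
      · exact absurd h hc
      · exact absurd h.symm hc'
    · intro c
      induction c using SimpleGraph.ConnectedComponent.ind with | _ a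
      by_cases ha : G.Reachable a u
      · refine ⟨⟨G.connectedComponentMk v, ?_⟩, ?_⟩
        · rw [ne_eq, SimpleGraph.ConnectedComponent.eq]
          exact fun h => huv h.symm
        · simp only [f, SimpleGraph.ConnectedComponent.map_mk, SimpleGraph.Hom.coe_ofLE, id,
            SimpleGraph.ConnectedComponent.eq]
          exact hadj.reachable.symm.trans (ha.symm.mono hle)
      · refine ⟨⟨G.connectedComponentMk a, ?_⟩, rfl⟩
        rwa [ne_eq, SimpleGraph.ConnectedComponent.eq]
  rw [← Nat.card_eq_of_bijective f hf]
  have := Fintype.ofFinite G.ConnectedComponent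
  rw [Nat.card_eq_fintype_card, Nat.card_eq_fintype_card, Fintype.card_subtype_compl,
    Fintype.card_subtype_eq]
  exact Nat.sub_add_cancel (Fintype.card_pos_iff.2 ⟨G.connectedComponentMk u⟩)

/-- A forest has as many vertices as edges and components together. -/
lemma SimpleGraph.IsAcyclic.ncard_edgeSet_add_card [Finite V] {F : SimpleGraph V}
    (hF : F.IsAcyclic) :
    F.edgeSet.ncard + Nat.card F.ConnectedComponent = Nat.card V := by
  induction hm : F.edgeSet.ncard generalizing F with
  | zero =>
    have : F = ⊥ := by
      rwa [Set.ncard_eq_zero (Set.toFinite _), SimpleGraph.edgeSet_eq_empty] at hm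
    subst this
    rw [zero_add]
    refine (Nat.card_eq_of_bijective (SimpleGraph.connectedComponentMk _) ⟨?_, ?_⟩).symm
    · intro a b h
      rw [SimpleGraph.ConnectedComponent.eq] at h
      exact SimpleGraph.reachable_bot.1 h
    · intro c
      induction c using SimpleGraph.ConnectedComponent.ind with | _ a
      exact ⟨a, rfl⟩
  | succ m ih =>
    obtain ⟨e, he⟩ : F.edgeSet.Nonempty := by
      rw [Set.nonempty_iff_ne_empty]
      rintro h
      simp [h] at hm
    induction e using Sym2.ind with | _ u v
    have hb := SimpleGraph.isBridge_iff.1 (SimpleGraph.isAcyclic_iff_forall_isBridge.1 hF he)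
    have hac : (F.deleteEdges {s(u, v)}).IsAcyclic := hF.anti (SimpleGraph.deleteEdges_le _)
    have hcard : (F.deleteEdges {s(u, v)}).edgeSet.ncard = m := by
      rw [SimpleGraph.edgeSet_deleteEdges, Set.ncard_sdiff_singleton_of_mem he, hm]
      rfl
    have h1 := ih hac hcard
    have h2 := card_connectedComponent_sup_edge hb
    have h3 : F.deleteEdges {s(u, v)} ⊔ SimpleGraph.edge u v = F := by
      ext a b
      rw [SimpleGraph.sup_adj, SimpleGraph.edge_adj, SimpleGraph.deleteEdges_adj]
      constructor
      · rintro (h | ⟨⟨rfl, rfl⟩ | ⟨rfl, rfl⟩, -⟩)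
        · exact h.1
        · exact he
        · exact (SimpleGraph.mem_edgeSet _).1 he |>.symm
      · intro h
        by_cases hs : s(a, b) = s(u, v)
        · exact Or.inr ⟨Sym2.eq_iff.1 hs, h.ne⟩
        · exact Or.inl ⟨h, by simpa using hs⟩
    rw [h3] at h2
    omega

lemma card_connectedComponent_congr {G H : SimpleGraph V} (h : G.Reachable = H.Reachable) :
    Nat.card G.ConnectedComponent = Nat.card H.ConnectedComponent := by
  unfold SimpleGraph.ConnectedComponent
  rw [h]

/-- Kruskal's algorithm for a nested family of graphs: one forest has the same connections as
`G t`, inside `G t`, for every `t` in a given finite set. -/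
lemma exists_isAcyclic_reachable_inf_eq (G : ℝ → SimpleGraph V) (hG : Monotone G)
    (s : Finset ℝ) :
    ∃ F : SimpleGraph V, F.IsAcyclic ∧ (∀ t ∈ s, (F ⊓ G t).Reachable = (G t).Reachable) ∧
      ∀ b, (∀ t ∈ s, t ≤ b) → F ≤ G b := by
  induction s using Finset.induction_on_max with
  | empty => exact ⟨⊥, SimpleGraph.isAcyclic_bot, by simp, fun _ _ => bot_le⟩
  | insert a s hs ih =>
    obtain ⟨F, hF, hreach, hle⟩ := ih
    obtain ⟨F', hFF', hF'G, hF', hr⟩ :=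
      SimpleGraph.exists_isAcyclic_reachable_eq_le_of_le_of_isAcyclic
        (hle a fun t ht => (hs t ht).le) hF
    refine ⟨F', hF', ?_, ?_⟩
    · intro t ht
      rcases Finset.mem_insert.1 ht with rfl | ht
      · rwa [inf_eq_left.2 hF'G]
      · ext u v
        refine ⟨fun h => h.mono inf_le_right, fun h => ?_⟩
        rw [← hreach t ht] at h
        exact h.mono (inf_le_inf_right _ hFF')
    · intro b hb
      exact hF'G.trans (hG (hb a (Finset.mem_insert_self _ _)))

end Forest

/-! ### The minimum spanning tree and the number of components of the threshold graphs -/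

/-- The graph of the edges of weight at most `t`. -/
def thresholdGraph {n : ℕ} (x : KEdge n → ℝ) (t : ℝ) : SimpleGraph (Fin n) where
  Adj u v := ∃ h : u ≠ v, x (kedge u v h) ≤ t
  symm := ⟨fun u v ⟨h, hx⟩ => ⟨h.symm, by
    have : kedge v u h.symm = kedge u v h := Subtype.ext Sym2.eq_swap
    rwa [this]⟩⟩
  loopless := ⟨fun u ⟨h, _⟩ => h rfl⟩

section Threshold

variable {n : ℕ} {x : KEdge n → ℝ} {t : ℝ}

lemma mem_edgeSet_thresholdGraph (e : KEdge n) :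
    (e : Sym2 (Fin n)) ∈ (thresholdGraph x t).edgeSet ↔ x e ≤ t := by
  obtain ⟨e, he⟩ := e
  induction e using Sym2.ind with | _ u v
  have huv : u ≠ v := by simpa using he
  exact ⟨fun ⟨_, h⟩ => h, fun h => ⟨huv, h⟩⟩

lemma thresholdGraph_mono (x : KEdge n → ℝ) : Monotone (thresholdGraph x) :=
  fun _ _ hst _ _ ⟨h, hx⟩ => ⟨h, hx.trans hst⟩

/-- A spanning tree with the same connections as every threshold graph; a minimum spanning
tree. -/
lemma exists_isTree_reachable_inf_thresholdGraph (hn : 0 < n) (x : KEdge n → ℝ) :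
    ∃ T : SimpleGraph (Fin n), T.IsTree ∧
      ∀ t, (T ⊓ thresholdGraph x t).Reachable = (thresholdGraph x t).Reachable := by
  classical
  obtain ⟨F, hF, hreach, -⟩ := exists_isAcyclic_reachable_inf_eq (thresholdGraph x)
    (thresholdGraph_mono x) (Finset.univ.image x)
  have key : ∀ t, (F ⊓ thresholdGraph x t).Reachable = (thresholdGraph x t).Reachable := by
    intro t
    by_cases hne : ((Finset.univ.image x).filter (· ≤ t)).Nonempty
    · obtain ⟨m, hm, hmax⟩ := Finset.exists_max_image _ id hne
      rw [Finset.mem_filter] at hm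
      have : thresholdGraph x t = thresholdGraph x m := by
        refine le_antisymm ?_ (thresholdGraph_mono x hm.2)
        rintro u v ⟨h, hx⟩
        exact ⟨h, hmax _ (by simp [hx])⟩
      rw [this]
      exact hreach m hm.1
    · have : thresholdGraph x t = ⊥ := by
        refine eq_bot_iff.2 ?_
        rintro u v ⟨h, hx⟩
        exact (hne ⟨x (kedge u v h), by simp [hx]⟩).elim
      rw [this, inf_bot_eq]
  obtain ⟨b, hb⟩ : ∃ b, ∀ e, x e ≤ b := by
    obtain ⟨b, hb⟩ := (Set.finite_range x).bddAbove
    exact ⟨b, fun e => hb ⟨e, rfl⟩⟩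
  have : Nonempty (Fin n) := ⟨⟨0, hn⟩⟩
  refine ⟨F, ⟨⟨fun u v => ?_⟩, hF⟩, key⟩
  by_cases huv : u = v
  · exact huv ▸ .refl _
  · have h1 : (thresholdGraph x b).Adj u v := ⟨huv, hb _⟩
    have h2 := h1.reachable
    rw [← key b] at h2
    exact h2.mono inf_le_left

lemma one_le_card_connectedComponent (hn : 0 < n) (G : SimpleGraph (Fin n)) :
    1 ≤ Nat.card G.ConnectedComponent := by
  have : Nonempty G.ConnectedComponent := ⟨G.connectedComponentMk ⟨0, hn⟩⟩
  exact Nat.card_pos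

lemma SimpleGraph.IsTree.ncard_lt_eq {T : SimpleGraph (Fin n)} (hT : T.IsTree) (x : KEdge n → ℝ) (t : ℝ) :
    {e : KEdge n | (e : Sym2 (Fin n)) ∈ T.edgeSet ∧ t < x e}.ncard =
      Nat.card (T ⊓ thresholdGraph x t).ConnectedComponent - 1 := by
  classical
  have h1 := (hT.isAcyclic.anti (inf_le_left (b := thresholdGraph x t))).ncard_edgeSet_add_card
  have h2 := hT.card_edgeFinset
  have himg : ∀ H : SimpleGraph (Fin n),
      H.edgeSet.ncard = {e : KEdge n | (e : Sym2 (Fin n)) ∈ H.edgeSet}.ncard := by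
    intro H
    rw [← Set.ncard_image_of_injective _ Subtype.val_injective]
    congr 1
    ext e
    refine ⟨fun he => ⟨⟨e, SimpleGraph.edgeSet_mono le_top he⟩, he, rfl⟩, ?_⟩
    rintro ⟨e', he', rfl⟩
    exact he'
  have h3 : T.edgeSet.ncard = T.edgeFinset.card := by
    rw [← SimpleGraph.coe_edgeFinset, Set.ncard_coe_finset]
  have h4 : {e : KEdge n | (e : Sym2 (Fin n)) ∈ T.edgeSet}.ncard =
      {e : KEdge n | (e : Sym2 (Fin n)) ∈ (T ⊓ thresholdGraph x t).edgeSet}.ncard +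
      {e : KEdge n | (e : Sym2 (Fin n)) ∈ T.edgeSet ∧ t < x e}.ncard := by
    rw [← Set.ncard_union_eq _ (Set.toFinite _) (Set.toFinite _)]
    · congr 1
      ext e
      simp only [Set.mem_ofPred_eq, Set.mem_union, SimpleGraph.edgeSet_inf, Set.mem_inter_iff,
        mem_edgeSet_thresholdGraph]
      rcases le_or_gt (x e) t with h | h
      · simp [h, not_lt.2 h]
      · simp [h, not_le.2 h]
    · rw [Set.disjoint_left]
      intro e he he'
      simp only [Set.mem_ofPred_eq, SimpleGraph.edgeSet_inf, Set.mem_inter_iff,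
        mem_edgeSet_thresholdGraph] at he he'
      exact absurd he.2 (not_le.2 he'.2)
  rw [himg] at h1 h3
  rw [Fintype.card_fin] at h2
  rw [Nat.card_fin] at h1
  omega

lemma graphWeight_nonneg (hx : ∀ e, 0 ≤ x e) (T : SimpleGraph (Fin n)) :
    0 ≤ graphWeight x T := by
  classical
  refine Finset.sum_nonneg fun e _ => ?_
  split_ifs
  exacts [hx e, le_rfl]

/-- The weight of a tree is the integral over `t` of its number of edges above `t`. -/
lemma ofReal_graphWeight {T : SimpleGraph (Fin n)} (hT : T.IsTree) (hx : ∀ e, 0 ≤ x e) :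
    ENNReal.ofReal (graphWeight x T) = ∫⁻ t in Set.Ioi (0 : ℝ),
      ((Nat.card (T ⊓ thresholdGraph x t).ConnectedComponent - 1 : ℕ) : ENNReal) := by
  classical
  have h1 : ∀ t, ((Nat.card (T ⊓ thresholdGraph x t).ConnectedComponent - 1 : ℕ) : ENNReal) =
      ∑ e : KEdge n, if (e : Sym2 (Fin n)) ∈ T.edgeSet then
        (Set.Iio (x e)).indicator (fun _ => (1 : ENNReal)) t else 0 := by
    intro t
    rw [← hT.ncard_lt_eq x t, Set.ncard_eq_toFinset_card', Finset.card_eq_sum_ones]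
    simp only [Set.toFinset_ofPred, Finset.sum_filter, Nat.cast_sum]
    refine Finset.sum_congr rfl fun e _ => ?_
    by_cases he : (e : Sym2 (Fin n)) ∈ T.edgeSet <;> by_cases ht : t < x e <;> simp [he, ht]
  simp_rw [h1]
  rw [lintegral_finsetSum]
  · unfold graphWeight
    rw [ENNReal.ofReal_sum_of_nonneg]
    · refine Finset.sum_congr rfl fun e _ => ?_
      by_cases he : (e : Sym2 (Fin n)) ∈ T.edgeSet
      · simp only [he, if_true]
        rw [lintegral_indicator measurableSet_Iio, lintegral_one,
          Measure.restrict_restrict measurableSet_Iio, Measure.restrict_apply_univ,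
          Set.inter_comm, Set.Ioi_inter_Iio, Real.volume_Ioo, sub_zero]
      · simp [he]
    · intro e _
      split_ifs
      exacts [hx e, le_rfl]
  · intro e _
    by_cases he : (e : Sym2 (Fin n)) ∈ T.edgeSet
    · simp only [he, if_true]
      exact measurable_const.indicator measurableSet_Iio
    · simp [he]

lemma mstWeight_le {T : SimpleGraph (Fin n)} (hT : T.IsTree) (x : KEdge n → ℝ) :
    mstWeight x ≤ graphWeight x T :=
  ciInf_le (Set.finite_range _).bddBelow
    (⟨T, hT⟩ : {T : SimpleGraph (Fin n) // T.IsTree})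

lemma exists_mstWeight_eq (hn : 0 < n) (x : KEdge n → ℝ) :
    ∃ T : SimpleGraph (Fin n), T.IsTree ∧ mstWeight x = graphWeight x T := by
  have : Nonempty {T : SimpleGraph (Fin n) // T.IsTree} := by
    obtain ⟨T, hT, -⟩ := exists_isTree_reachable_inf_thresholdGraph hn (0 : KEdge n → ℝ)
    exact ⟨⟨T, hT⟩⟩
  obtain ⟨T, hT⟩ := exists_eq_ciInf_of_finite
    (f := fun T : {T : SimpleGraph (Fin n) // T.IsTree} => graphWeight x T.1)
  exact ⟨T.1, T.2, hT.symm⟩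

/-- The minimum weight of a spanning tree is the integral of the number of components of the
threshold graph, less one. -/
theorem ofReal_mstWeight (hn : 0 < n) (hx : ∀ e, 0 ≤ x e) :
    ENNReal.ofReal (mstWeight x) = ∫⁻ t in Set.Ioi (0 : ℝ),
      ((Nat.card (thresholdGraph x t).ConnectedComponent - 1 : ℕ) : ENNReal) := by
  apply le_antisymm
  · obtain ⟨T, hT, hr⟩ := exists_isTree_reachable_inf_thresholdGraph hn x
    refine (ENNReal.ofReal_le_ofReal (mstWeight_le hT x)).trans ?_
    rw [ofReal_graphWeight hT hx]
    refine le_of_eq (lintegral_congr fun t => ?_)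
    rw [card_connectedComponent_congr (hr t)]
  · obtain ⟨T, hT, h⟩ := exists_mstWeight_eq hn x
    rw [h, ofReal_graphWeight hT hx]
    refine lintegral_mono fun t => ?_
    exact Nat.cast_le.2 (Nat.sub_le_sub_right
      (SimpleGraph.ConnectedComponent.card_le_card_of_le inf_le_right) 1)

end Threshold

/-! ### From the simplex to independent exponential weights -/

section Exponential

open ProbabilityTheory

/-- The joint law of independent exponential variables with rates `α`. -/
noncomputable def expProduct {ι : Type*} [Fintype ι] (α : ι → ℝ) : Measure (ι → ℝ) :=
  Measure.pi fun e => expMeasure (α e)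

lemma expMeasure_eq_withDensity {r : ℝ} :
    expMeasure r = volume.withDensity (exponentialPDF r) := rfl

lemma expProduct_eq_withDensity {ι : Type*} [Fintype ι] {α : ι → ℝ} (hα : ∀ e, 0 < α e) :
    expProduct α = volume.withDensity fun x => ∏ e, exponentialPDF (α e) (x e) := by
  have hprob : ∀ e, IsProbabilityMeasure (expMeasure (α e)) :=
    fun e => isProbabilityMeasure_expMeasure (hα e)
  have hmeas : ∀ e, Measurable (exponentialPDFReal (α e)) :=
    fun e => measurable_exponentialPDFReal _
  unfold expProduct
  refine Measure.pi_eq fun s hs => ?_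
  have hint : ∀ e, Integrable ((s e).indicator (exponentialPDFReal (α e))) := by
    intro e
    refine Integrable.indicator ?_ (hs e)
    refine ⟨(hmeas e).aestronglyMeasurable, ?_⟩
    rw [hasFiniteIntegral_iff_ofReal
      (Eventually.of_forall fun x => exponentialPDFReal_nonneg (hα e) x)]
    exact (lintegral_exponentialPDF_eq_one (hα e)).trans_lt ENNReal.one_lt_top
  have hnn : ∀ e x, 0 ≤ (s e).indicator (exponentialPDFReal (α e)) x :=
    fun e x => Set.indicator_nonneg (fun _ _ => exponentialPDFReal_nonneg (hα e) _) _
  have h1 : ∀ e, expMeasure (α e) (s e) =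
      ENNReal.ofReal (∫ x, (s e).indicator (exponentialPDFReal (α e)) x) := by
    intro e
    rw [ofReal_integral_eq_lintegral_ofReal (hint e) (Eventually.of_forall (hnn e)),
      expMeasure_eq_withDensity, withDensity_apply _ (hs e),
      ← lintegral_indicator (hs e)]
    refine lintegral_congr fun x => ?_
    by_cases hx : x ∈ s e <;> simp [hx, exponentialPDF_eq, exponentialPDFReal, gammaPDFReal]
  simp_rw [h1]
  rw [withDensity_apply _ (MeasurableSet.univ_pi hs), ← lintegral_indicator (.univ_pi hs),
    ← ENNReal.ofReal_prod_of_nonneg fun e _ => integral_nonneg (hnn e),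
    ← integral_fintype_prod_volume_eq_prod, ofReal_integral_eq_lintegral_ofReal
      (μ := (volume : Measure (ι → ℝ))) (Integrable.fintype_prod hint)
      (Eventually.of_forall fun x => Finset.prod_nonneg fun e _ => hnn e _)]
  refine lintegral_congr fun x => ?_
  rw [ENNReal.ofReal_prod_of_nonneg fun e _ => hnn e _]
  by_cases hx : x ∈ Set.univ.pi s
  · rw [Set.indicator_of_mem hx]
    refine Finset.prod_congr rfl fun e _ => ?_
    rw [Set.indicator_of_mem (hx e trivial)]
    rfl
  · rw [Set.indicator_of_notMem hx]
    obtain ⟨e, he⟩ : ∃ e, x e ∉ s e := by simpa using hx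
    exact (Finset.prod_eq_zero (Finset.mem_univ e) (by simp [he])).symm

lemma lintegral_exp_neg_Ioi_ge {l : ℝ} (hl : 0 ≤ l) :
    ∫⁻ t in Set.Ioi (0 : ℝ), (Set.Ici l).indicator (fun t => ENNReal.ofReal (Real.exp (-t))) t =
      ENNReal.ofReal (Real.exp (-l)) := by
  rw [lintegral_indicator measurableSet_Ici, Measure.restrict_restrict measurableSet_Ici]
  have : (Set.Ici l ∩ Set.Ioi 0 : Set ℝ) =ᵐ[volume] Set.Ioi l := by
    have h1 : (Set.Ici l ∩ Set.Ioi 0 : Set ℝ) =ᵐ[volume] (Set.Ioi l ∩ Set.Ioi 0 : Set ℝ) :=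
      Ioi_ae_eq_Ici.symm.inter (ae_eq_refl _)
    rwa [Set.Ioi_inter_Ioi, sup_of_le_left hl] at h1
  rw [setLIntegral_congr this, ← integral_exp_neg_Ioi l,
    ofReal_integral_eq_lintegral_ofReal (integrableOn_exp_neg_Ioi l)
      (Eventually.of_forall fun _ => (Real.exp_pos _).le)]

lemma lintegral_exp_neg_mul_pow (m : ℕ) :
    ∫⁻ t in Set.Ioi (0 : ℝ), ENNReal.ofReal (Real.exp (-t)) * ENNReal.ofReal t ^ m =
      (m ! : ENNReal) := by
  have h0 : (0 : ℝ) < (m : ℝ) + 1 := by positivity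
  have h := Real.Gamma_eq_integral h0
  rw [Real.Gamma_nat_eq_factorial, add_sub_cancel_right] at h
  have hc := Real.GammaIntegral_convergent h0
  rw [add_sub_cancel_right] at hc
  rw [← ENNReal.ofReal_natCast, h, ofReal_integral_eq_lintegral_ofReal hc]
  · refine setLIntegral_congr_fun measurableSet_Ioi fun t ht => ?_
    rw [Set.mem_Ioi] at ht
    simp only [Real.rpow_natCast]
    rw [ENNReal.ofReal_mul (Real.exp_pos _).le, ENNReal.ofReal_pow ht.le]
  · refine (ae_restrict_iff' measurableSet_Ioi).2 (Eventually.of_forall fun t ht => ?_)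
    have : (0 : ℝ) < t := ht
    positivity

variable {n : ℕ} {α : KEdge n → ℝ}

lemma measurableSet_weightSimplex (L : ℝ) (α : KEdge n → ℝ) :
    MeasurableSet (weightSimplex n L α) := by
  unfold weightSimplex
  refine MeasurableSet.inter ?_ ?_
  · change MeasurableSet {x : KEdge n → ℝ | ∀ e, 0 ≤ x e}
    simp only [Set.ofPred_forall]
    exact MeasurableSet.iInter fun e => measurableSet_le measurable_const (measurable_pi_apply e)
  · exact measurableSet_le (f := fun x : KEdge n → ℝ => ∑ e, α e * x e) (by fun_prop)
      measurable_const

/-- The density `e^{-∑ α_e x_e}` as a mixture of indicators of simplices. -/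
lemma prod_exponentialPDF_eq (hα : ∀ e, 0 < α e) (x : KEdge n → ℝ) :
    ∏ e, exponentialPDF (α e) (x e) = (∏ e, ENNReal.ofReal (α e)) *
      ∫⁻ t in Set.Ioi (0 : ℝ), ENNReal.ofReal (Real.exp (-t)) *
        (weightSimplex n t α).indicator 1 x := by
  by_cases hx : ∀ e, 0 ≤ x e
  · have h1 : ∀ e, exponentialPDF (α e) (x e) =
        ENNReal.ofReal (α e) * ENNReal.ofReal (Real.exp (-(α e * x e))) := fun e => by
      rw [exponentialPDF_of_nonneg (hx e), ENNReal.ofReal_mul (hα e).le]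
    simp_rw [h1]
    rw [Finset.prod_mul_distrib, ← ENNReal.ofReal_prod_of_nonneg
      (f := fun e => Real.exp (-(α e * x e))) (fun e _ => (Real.exp_pos _).le), ← Real.exp_sum,
      Finset.sum_neg_distrib, ← lintegral_exp_neg_Ioi_ge
        (Finset.sum_nonneg fun e _ => mul_nonneg (hα e).le (hx e))]
    congr 1
    refine lintegral_congr fun t => ?_
    by_cases ht : ∑ e, α e * x e ≤ t
    · have : x ∈ weightSimplex n t α := ⟨hx, ht⟩
      rw [Set.indicator_of_mem this, Set.indicator_of_mem (Set.mem_Ici.2 ht), Pi.one_apply,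
        mul_one]
    · have : x ∉ weightSimplex n t α := fun h => ht h.2
      rw [Set.indicator_of_notMem this, Set.indicator_of_notMem (by simpa using ht), mul_zero]
  · have h2 : ∀ t, x ∉ weightSimplex n t α := fun t h => hx h.1
    push Not at hx
    obtain ⟨e, he⟩ := hx
    rw [Finset.prod_eq_zero (Finset.mem_univ e) (exponentialPDF_of_neg he)]
    simp [h2]

lemma measurable_weightSimplex_indicator (α : KEdge n → ℝ) :
    Measurable fun p : (KEdge n → ℝ) × ℝ =>
      (weightSimplex n p.2 α).indicator (1 : (KEdge n → ℝ) → ENNReal) p.1 := by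
  have : MeasurableSet {p : (KEdge n → ℝ) × ℝ | p.1 ∈ weightSimplex n p.2 α} := by
    unfold weightSimplex
    refine MeasurableSet.inter ?_ ?_
    · change MeasurableSet {p : (KEdge n → ℝ) × ℝ | ∀ e, 0 ≤ p.1 e}
      simp only [Set.ofPred_forall]
      exact MeasurableSet.iInter fun e => measurableSet_le measurable_const (by fun_prop)
    · exact measurableSet_le (f := fun p : (KEdge n → ℝ) × ℝ => ∑ e, α e * p.1 e)
        (by fun_prop) measurable_snd
  exact (measurable_const (a := (1 : ENNReal))).indicator this

/-- Integrals over the simplices of a homogeneous function. -/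
lemma setLIntegral_weightSimplex_smul {f : (KEdge n → ℝ) → ENNReal} (hf : Measurable f) {p : ℕ}
    (hp : ∀ (c : ℝ) x, 0 < c → f (c • x) = ENNReal.ofReal c ^ p * f x) {t : ℝ} (ht : 0 < t) :
    ∫⁻ x in weightSimplex n t α, f x =
      ENNReal.ofReal t ^ (Fintype.card (KEdge n) + p) * ∫⁻ x in weightSimplex n 1 α, f x := by
  have hmem : ∀ x, t • x ∈ weightSimplex n t α ↔ x ∈ weightSimplex n 1 α := by
    intro x
    simp only [weightSimplex, Set.mem_ofPred_eq, Pi.smul_apply, smul_eq_mul]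
    refine and_congr (forall_congr' fun e => ?_) ?_
    · exact mul_nonneg_iff_of_pos_left ht
    · rw [Finset.sum_congr rfl fun e _ => mul_left_comm (α e) t (x e), ← Finset.mul_sum,
        mul_le_iff_le_one_right ht]
  have hF : Measurable ((weightSimplex n t α).indicator f) :=
    hf.indicator (measurableSet_weightSimplex t α)
  have h1 : ∫⁻ x, (weightSimplex n t α).indicator f (t • x) =
      ENNReal.ofReal t ^ p * ∫⁻ x in weightSimplex n 1 α, f x := by
    rw [← lintegral_const_mul _ hf, ← lintegral_indicator (measurableSet_weightSimplex 1 α)]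
    refine lintegral_congr fun x => ?_
    by_cases hx : x ∈ weightSimplex n 1 α
    · rw [Set.indicator_of_mem hx, Set.indicator_of_mem ((hmem x).2 hx), hp t x ht]
    · rw [Set.indicator_of_notMem hx, Set.indicator_of_notMem (mt (hmem x).1 hx)]
  have h2 : ∫⁻ x, (weightSimplex n t α).indicator f (t • x) =
      ENNReal.ofReal ((t ^ Fintype.card (KEdge n))⁻¹) * ∫⁻ x in weightSimplex n t α, f x := by
    rw [← lintegral_map hF (by fun_prop : Measurable fun x : KEdge n → ℝ => t • x),
      Measure.map_addHaar_smul _ ht.ne', lintegral_smul_measure, lintegral_indicator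
      (measurableSet_weightSimplex t α), Module.finrank_pi, abs_of_nonneg (by positivity),
      smul_eq_mul]
  rw [h1, ENNReal.ofReal_inv_of_pos (by positivity), ENNReal.ofReal_pow ht.le] at h2
  rw [pow_add, mul_assoc, h2, ← mul_assoc, ENNReal.mul_inv_cancel, one_mul]
  · exact pow_ne_zero _ (by simpa using ht)
  · exact ENNReal.pow_ne_top ENNReal.ofReal_ne_top

lemma lintegral_expProduct_of_homogeneous (hα : ∀ e, 0 < α e)
    {f : (KEdge n → ℝ) → ENNReal} (hf : Measurable f) {p : ℕ}
    (hp : ∀ (c : ℝ) x, 0 < c → f (c • x) = ENNReal.ofReal c ^ p * f x) :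
    ∫⁻ x, f x ∂expProduct α = (∏ e, ENNReal.ofReal (α e)) *
      ((Fintype.card (KEdge n) + p)! * ∫⁻ x in weightSimplex n 1 α, f x) := by
  have hind := measurable_weightSimplex_indicator (n := n) α
  have hpdf : Measurable fun x : KEdge n → ℝ => ∏ e, exponentialPDF (α e) (x e) :=
    Finset.measurable_fun_prod Finset.univ fun e _ =>
      (measurable_exponentialPDFReal (α e)).ennreal_ofReal.comp (measurable_pi_apply e)
  have hmeas : Measurable fun q : (KEdge n → ℝ) × ℝ => f q.1 *
      (ENNReal.ofReal (Real.exp (-q.2)) * (weightSimplex n q.2 α).indicator 1 q.1) :=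
    (hf.comp measurable_fst).mul ((by fun_prop : Measurable fun q : (KEdge n → ℝ) × ℝ =>
      ENNReal.ofReal (Real.exp (-q.2))).mul hind)
  rw [expProduct_eq_withDensity hα, lintegral_withDensity_eq_lintegral_mul _ hpdf hf]
  calc ∫⁻ x, ((fun x : KEdge n → ℝ => ∏ e, exponentialPDF (α e) (x e)) * f) x
      = ∫⁻ x, (∏ e, ENNReal.ofReal (α e)) * ∫⁻ t in Set.Ioi (0 : ℝ), f x *
          (ENNReal.ofReal (Real.exp (-t)) * (weightSimplex n t α).indicator 1 x) := by
        refine lintegral_congr fun x => ?_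
        rw [Pi.mul_apply, prod_exponentialPDF_eq hα, mul_assoc, mul_comm _ (f x),
          lintegral_const_mul]
        exact (by fun_prop : Measurable fun t : ℝ => ENNReal.ofReal (Real.exp (-t))).mul
          (hind.comp (measurable_const.prodMk measurable_id))
    _ = (∏ e, ENNReal.ofReal (α e)) * ∫⁻ t in Set.Ioi (0 : ℝ), ∫⁻ x, f x *
          (ENNReal.ofReal (Real.exp (-t)) * (weightSimplex n t α).indicator 1 x) := by
        rw [lintegral_const_mul _ hmeas.lintegral_prod_right']
        rw [lintegral_lintegral_swap hmeas.aemeasurable]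
    _ = (∏ e, ENNReal.ofReal (α e)) * ∫⁻ t in Set.Ioi (0 : ℝ), ENNReal.ofReal (Real.exp (-t)) *
          ENNReal.ofReal t ^ (Fintype.card (KEdge n) + p) * ∫⁻ x in weightSimplex n 1 α, f x := by
        congr 1
        refine setLIntegral_congr_fun measurableSet_Ioi fun t ht => ?_
        rw [mul_assoc, ← setLIntegral_weightSimplex_smul hf hp ht, ← lintegral_const_mul _ hf,
          ← lintegral_indicator (measurableSet_weightSimplex t α)]
        refine lintegral_congr fun x => ?_
        by_cases hx : x ∈ weightSimplex n t α
        · rw [Set.indicator_of_mem hx, Set.indicator_of_mem hx, Pi.one_apply, mul_one, mul_comm]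
        · rw [Set.indicator_of_notMem hx, Set.indicator_of_notMem hx, mul_zero, mul_zero]
    _ = _ := by
        rw [lintegral_mul_const _ (by fun_prop), lintegral_exp_neg_mul_pow]

instance isProbabilityMeasure_expProduct {ι : Type*} [Fintype ι] {α : ι → ℝ}
    [h : Fact (∀ e, 0 < α e)] : IsProbabilityMeasure (expProduct α) := by
  have : ∀ e, IsProbabilityMeasure (expMeasure (α e)) :=
    fun e => isProbabilityMeasure_expMeasure (h.out e)
  unfold expProduct
  infer_instance

lemma card_KEdge (n : ℕ) : Fintype.card (KEdge n) = n.choose 2 := by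
  classical
  rw [← SimpleGraph.edgeFinset_card, SimpleGraph.card_edgeFinset_top_eq_card_choose_two,
    Fintype.card_fin]

/-- On functions homogeneous of degree one, the uniform law on the simplex and the product of
exponential laws agree up to the factor `N / (N + 1)`. -/
lemma lintegral_simplexLaw_of_homogeneous (hn : 2 ≤ n) (hα : ∀ e, 0 < α e)
    {f : (KEdge n → ℝ) → ENNReal} (hf : Measurable f)
    (hp : ∀ (c : ℝ) x, 0 < c → f (c • x) = ENNReal.ofReal c * f x) :
    ((n.choose 2 : ENNReal) + 1) * ∫⁻ x, f x ∂simplexLaw n α =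
      (n.choose 2 : ENNReal) * ∫⁻ x, f x ∂expProduct α := by
  have := Fact.mk hα
  have hM : 0 < n.choose 2 := Nat.choose_pos hn
  have hM' : (0 : ℝ) < n.choose 2 := by exact_mod_cast hM
  have h0 := lintegral_expProduct_of_homogeneous hα (f := 1) measurable_one (p := 0)
    (fun c x _ => by simp)
  have h1 := lintegral_expProduct_of_homogeneous hα hf (p := 1)
    (fun c x hc => by rw [hp c x hc, pow_one])
  have h2 := setLIntegral_weightSimplex_smul (α := α) (f := 1) measurable_one (p := 0)
    (fun c x _ => by simp) hM'
  have h3 := setLIntegral_weightSimplex_smul (α := α) hf (p := 1)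
    (fun c x hc => by rw [hp c x hc, pow_one]) hM'
  simp only [Pi.one_apply, lintegral_one, measure_univ, Measure.restrict_apply_univ, add_zero,
    card_KEdge, ENNReal.ofReal_natCast] at h0 h1 h2 h3
  rw [simplexLaw, ProbabilityTheory.cond, lintegral_smul_measure, smul_eq_mul, h3, h2, h1]
  set C := ∏ e, ENNReal.ofReal (α e)
  set J := volume (weightSimplex n 1 α)
  set I := ∫⁻ x in weightSimplex n 1 α, f x
  set M := n.choose 2
  have hJ0 : J ≠ 0 := by
    rintro h
    simp [h] at h0
  have hJ : J⁻¹ = C * M ! := by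
    refine (ENNReal.eq_inv_of_mul_eq_one_left ?_).symm
    rw [mul_assoc, ← h0]
  have hMt : (M : ENNReal) ^ M ≠ ⊤ := ENNReal.pow_ne_top (ENNReal.natCast_ne_top M)
  have hM0 : (M : ENNReal) ^ M ≠ 0 := pow_ne_zero _ (by exact_mod_cast hM.ne')
  rw [ENNReal.mul_inv (Or.inl hM0) (Or.inl hMt), hJ, pow_succ, Nat.factorial_succ]
  push_cast
  calc ((M : ENNReal) + 1) * (((M : ENNReal) ^ M)⁻¹ * (C * M !) * ((M : ENNReal) ^ M * M * I))
      = (((M : ENNReal) ^ M)⁻¹ * (M : ENNReal) ^ M) *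
          (M * (C * (((M : ENNReal) + 1) * M ! * I))) := by ring
    _ = _ := by rw [ENNReal.inv_mul_cancel hM0 hMt, one_mul]

lemma mstWeight_smul {c : ℝ} (hc : 0 ≤ c) (x : KEdge n → ℝ) :
    mstWeight (c • x) = c * mstWeight x := by
  classical
  unfold mstWeight
  rw [Real.mul_iInf_of_nonneg hc]
  congr 1
  ext T
  unfold graphWeight
  rw [Finset.mul_sum]
  refine Finset.sum_congr rfl fun e _ => ?_
  split_ifs <;> simp

lemma measurable_mstWeight : Measurable (mstWeight : (KEdge n → ℝ) → ℝ) := by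
  classical
  unfold mstWeight
  refine Measurable.iInf fun T => ?_
  unfold graphWeight
  refine Finset.measurable_fun_sum _ fun e _ => ?_
  split_ifs
  · exact measurable_pi_apply e
  · exact measurable_const

lemma mstWeight_nonneg {x : KEdge n → ℝ} (hx : ∀ e, 0 ≤ x e) : 0 ≤ mstWeight x :=
  Real.iInf_nonneg fun T => graphWeight_nonneg hx T.1

/-- The expected minimum spanning tree weight in terms of independent exponential weights. -/
theorem expectedMST_eq (hn : 2 ≤ n) (hα : ∀ e, 0 < α e) :
    expectedMST n α = (n.choose 2 : ℝ) / ((n.choose 2 : ℝ) + 1) *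
      (∫⁻ x, ENNReal.ofReal (mstWeight x) ∂expProduct α).toReal := by
  have h := lintegral_simplexLaw_of_homogeneous hn hα
    (f := fun x => ENNReal.ofReal (mstWeight x)) measurable_mstWeight.ennreal_ofReal
    (fun c x hc => by rw [mstWeight_smul hc.le, ENNReal.ofReal_mul hc.le])
  have h1 : expectedMST n α = (∫⁻ x, ENNReal.ofReal (mstWeight x) ∂simplexLaw n α).toReal := by
    unfold expectedMST
    refine integral_eq_lintegral_of_nonneg_ae ?_ measurable_mstWeight.aestronglyMeasurable
    have : ∀ᵐ x ∂simplexLaw n α, x ∈ weightSimplex n (n.choose 2 : ℝ) α :=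
      ProbabilityTheory.ae_cond_mem (measurableSet_weightSimplex _ α)
    filter_upwards [this] with x hx
    exact mstWeight_nonneg hx.1
  have h2 := congrArg ENNReal.toReal h
  rw [ENNReal.toReal_mul, ENNReal.toReal_mul, ← h1, ENNReal.toReal_natCast,
    ENNReal.toReal_add (ENNReal.natCast_ne_top _) ENNReal.one_ne_top, ENNReal.toReal_natCast,
    ENNReal.toReal_one] at h2
  have h3 : ((n.choose 2 : ℝ) + 1) ≠ 0 := by positivity
  field_simp
  linarith

end Exponential

/-! ### Components as vertex sets -/

section Components

variable {V : Type*}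

/-- No edge of `G` leaves the vertex set `C`. -/
def IsClosedSet (G : SimpleGraph V) (C : Finset V) : Prop :=
  ∀ u ∈ C, ∀ w, w ∉ C → ¬ G.Adj u w

/-- `C` is the vertex set of a connected component of `G`. -/
def IsComponentSet (G : SimpleGraph V) (C : Finset V) : Prop :=
  ∃ c : G.ConnectedComponent, c.supp = (C : Set V)

variable {G : SimpleGraph V} {C : Finset V}

lemma IsClosedSet.mem_of_reachable (h : IsClosedSet G C) {u w : V} (hu : u ∈ C)
    (hr : G.Reachable u w) : w ∈ C := by
  obtain ⟨p⟩ := hr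
  induction p with
  | nil => exact hu
  | cons hadj p ih => exact ih (by_contra fun hc => h _ hu _ hc hadj)

lemma IsComponentSet.isClosedSet (h : IsComponentSet G C) : IsClosedSet G C := by
  obtain ⟨c, hc⟩ := h
  intro u hu w hw hadj
  rw [← Finset.mem_coe, ← hc] at hu hw
  rw [SimpleGraph.ConnectedComponent.mem_supp_iff] at hu hw
  exact hw (hu ▸ (SimpleGraph.ConnectedComponent.eq.2 hadj.reachable.symm))

lemma IsComponentSet.nonempty (h : IsComponentSet G C) : C.Nonempty := by
  obtain ⟨c, hc⟩ := h
  rw [← Finset.coe_nonempty, ← hc]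
  exact c.nonempty_supp

lemma IsComponentSet.disjoint {C C' : Finset V} (h : IsComponentSet G C)
    (h' : IsComponentSet G C') (hne : C ≠ C') : Disjoint C C' := by
  obtain ⟨c, hc⟩ := h
  obtain ⟨c', hc'⟩ := h'
  rw [← Finset.disjoint_coe, ← hc, ← hc']
  refine SimpleGraph.pairwise_disjoint_supp_connectedComponent G ?_
  rintro rfl
  exact hne (Finset.coe_injective (hc.symm.trans hc'))

variable [DecidableEq V] {R S : Finset V}

/-- Every vertex of `S` is joined to `R` by a path inside `R ∪ S`. This is encoded by cuts: each
nonempty part `U` of `S` has an edge to the rest of `R ∪ S`. -/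
def ReachedWithin (G : SimpleGraph V) (R S : Finset V) : Prop :=
  ∀ U ⊆ S, U.Nonempty → ∃ u ∈ U, ∃ w ∈ (R ∪ S) \ U, G.Adj u w

lemma isComponentSet_iff {v : V} (hv : v ∈ C) :
    IsComponentSet G C ↔ ReachedWithin G {v} (C.erase v) ∧ IsClosedSet G C := by
  have hins : {v} ∪ C.erase v = C := by
    rw [← Finset.insert_eq, Finset.insert_erase hv]
  constructor
  · intro h
    refine ⟨fun U hU ⟨u, hu⟩ => ?_, h.isClosedSet⟩
    rw [hins]
    by_contra! hno
    have hUC : U ⊆ C := hU.trans (Finset.erase_subset _ _)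
    have hcl : IsClosedSet G U := by
      intro a ha w hw
      by_cases hwC : w ∈ C
      · exact hno a ha w (Finset.mem_sdiff.2 ⟨hwC, hw⟩)
      · exact h.isClosedSet a (hUC ha) w hwC
    obtain ⟨c, hc⟩ := h
    have hr : G.Reachable u v := by
      have h1 : u ∈ c.supp := hc ▸ hUC hu
      have h2 : v ∈ c.supp := hc ▸ hv
      rw [SimpleGraph.ConnectedComponent.mem_supp_iff] at h1 h2
      exact SimpleGraph.ConnectedComponent.eq.1 (h1.trans h2.symm)
    exact (Finset.mem_erase.1 (hU (hcl.mem_of_reachable hu hr))).1 rfl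
  · rintro ⟨hR, hcl⟩
    refine ⟨G.connectedComponentMk v, Set.Subset.antisymm ?_ ?_⟩
    · intro w hw
      rw [SimpleGraph.ConnectedComponent.mem_supp_iff, SimpleGraph.ConnectedComponent.eq] at hw
      exact hcl.mem_of_reachable hv hw.symm
    · classical
      by_contra hno
      rw [Set.not_subset] at hno
      obtain ⟨a, haC, ha⟩ := hno
      have haC' : a ∈ C := haC
      obtain ⟨u, hu, w, hw, hadj⟩ := hR
        (C.filter (· ∉ (G.connectedComponentMk v).supp))
        (by
          intro b hb
          rw [Finset.mem_filter] at hb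
          refine Finset.mem_erase.2 ⟨?_, hb.1⟩
          rintro rfl
          exact hb.2 rfl)
        ⟨a, Finset.mem_filter.2 ⟨haC', ha⟩⟩
      rw [hins, Finset.mem_sdiff, Finset.mem_filter, not_and_not_right] at hw
      rw [Finset.mem_filter, SimpleGraph.ConnectedComponent.mem_supp_iff] at hu
      have hws := hw.2 hw.1
      rw [SimpleGraph.ConnectedComponent.mem_supp_iff] at hws
      exact hu.2 ((SimpleGraph.ConnectedComponent.eq.2 hadj.reachable).trans hws)

/-- Exploration of the vertex `r`: its neighbours in `S` take its place. -/
lemma reachedWithin_iff_explore {r : V} (hr : r ∈ R) (hrS : r ∉ S) {B : Finset V} (hB : B ⊆ S)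
    (hN : ∀ s ∈ S, G.Adj r s ↔ s ∈ B) :
    ReachedWithin G R S ↔ ReachedWithin G (R.erase r ∪ B) (S \ B) := by
  constructor
  · intro h U hU hne
    obtain ⟨u, hu, w, hw, hadj⟩ := h U (hU.trans Finset.sdiff_subset) hne
    refine ⟨u, hu, w, ?_, hadj⟩
    have huS := Finset.mem_sdiff.1 (hU hu)
    have hwr : w ≠ r := by
      rintro rfl
      exact huS.2 ((hN u huS.1).1 hadj.symm)
    simp only [Finset.mem_sdiff, Finset.mem_union, Finset.mem_erase] at hw ⊢
    tauto
  · intro h U hU hne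
    by_cases hUB : ∃ b ∈ U, b ∈ B
    · obtain ⟨b, hbU, hbB⟩ := hUB
      refine ⟨b, hbU, r, ?_, ((hN b (hB hbB)).2 hbB).symm⟩
      exact Finset.mem_sdiff.2 ⟨Finset.mem_union_left _ hr, fun h => hrS (hU h)⟩
    · push Not at hUB
      obtain ⟨u, hu, w, hw, hadj⟩ := h U
        (fun a ha => Finset.mem_sdiff.2 ⟨hU ha, hUB a ha⟩) hne
      refine ⟨u, hu, w, ?_, hadj⟩
      simp only [Finset.mem_sdiff, Finset.mem_union, Finset.mem_erase] at hw ⊢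
      refine ⟨?_, hw.2⟩
      rcases hw.1 with (h | h) | h
      · exact Or.inl h.2
      · exact Or.inr (hB h)
      · exact Or.inr h.1

lemma reachedWithin_empty_right (G : SimpleGraph V) (R : Finset V) : ReachedWithin G R ∅ :=
  fun _ hU ⟨u, hu⟩ => absurd (hU hu) (Finset.notMem_empty u)

lemma not_reachedWithin_empty_left (G : SimpleGraph V) (hS : S.Nonempty) :
    ¬ ReachedWithin G ∅ S := fun h => by
  obtain ⟨u, hu, w, hw, -⟩ := h S subset_rfl hS
  simp at hw

variable [Fintype V]

open Classical in
lemma card_connectedComponent_eq (G : SimpleGraph V) :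
    Nat.card G.ConnectedComponent = (Finset.univ.filter (IsComponentSet G)).card := by
  have := Fintype.ofFinite G.ConnectedComponent
  rw [Nat.card_eq_fintype_card, ← Finset.card_univ]
  refine Finset.card_bij (fun c _ => c.supp.toFinset) ?_ ?_ ?_
  · intro c _
    exact Finset.mem_filter.2 ⟨Finset.mem_univ _, c, by simp⟩
  · intro c _ c' _ h
    exact SimpleGraph.ConnectedComponent.supp_injective (Set.toFinset_inj.1 h)
  · intro C hC
    obtain ⟨c, hc⟩ := (Finset.mem_filter.1 hC).2
    exact ⟨c, Finset.mem_univ _, by simp [hc]⟩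

open Classical in
/-- There are at most `|V| / K` components with more than `K` vertices. -/
lemma card_large_components_mul_le (G : SimpleGraph V) (K : ℕ) :
    (Finset.univ.filter fun C : Finset V => IsComponentSet G C ∧ K < C.card).card * K ≤
      Fintype.card V := by
  calc _ = ∑ C ∈ Finset.univ.filter fun C : Finset V => IsComponentSet G C ∧ K < C.card, K := by
        rw [Finset.sum_const, smul_eq_mul]
    _ ≤ ∑ C ∈ Finset.univ.filter fun C : Finset V => IsComponentSet G C ∧ K < C.card, C.card :=
        Finset.sum_le_sum fun C hC => (Finset.mem_filter.1 hC).2.2.le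
    _ = ((Finset.univ.filter fun C : Finset V => IsComponentSet G C ∧ K < C.card).biUnion
          id).card := by
        refine (Finset.card_biUnion fun C hC C' hC' hne => ?_).symm
        exact (Finset.mem_filter.1 hC).2.1.disjoint (Finset.mem_filter.1 hC').2.1 hne
    _ ≤ _ := Finset.card_le_univ _

open Classical in
lemma card_connectedComponent_eq_add (G : SimpleGraph V) (K : ℕ) :
    Nat.card G.ConnectedComponent =
      (Finset.univ.filter fun C : Finset V => IsComponentSet G C ∧ C.card ≤ K).card +
      (Finset.univ.filter fun C : Finset V => IsComponentSet G C ∧ K < C.card).card := by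
  rw [card_connectedComponent_eq, ← Finset.card_filter_add_card_filter_not (fun C => C.card ≤ K),
    Finset.filter_filter, Finset.filter_filter]
  simp only [not_le]

open Classical in
/-- At most one component has more than half of the vertices. -/
lemma card_connectedComponent_sub_one_le (G : SimpleGraph V) :
    Nat.card G.ConnectedComponent - 1 ≤ (Finset.univ.filter fun C : Finset V =>
      IsClosedSet G C ∧ C.Nonempty ∧ 2 * C.card ≤ Fintype.card V).card := by
  rw [card_connectedComponent_eq_add G (Fintype.card V / 2), Nat.sub_le_iff_le_add]
  refine Nat.add_le_add (Finset.card_le_card ?_) (Finset.card_le_one.2 ?_)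
  · intro C hC
    rw [Finset.mem_filter] at hC ⊢
    exact ⟨hC.1, hC.2.1.isClosedSet, hC.2.1.nonempty, by omega⟩
  · intro C hC C' hC'
    rw [Finset.mem_filter] at hC hC'
    by_contra hne
    have h1 := Finset.card_union_of_disjoint (hC.2.1.disjoint hC'.2.1 hne)
    have h2 := Finset.card_le_univ (C ∪ C')
    omega

end Components

/-! ### Probabilities in the threshold graph -/

section Probability

open ProbabilityTheory

lemma measurableSet_thresholdGraph {n : ℕ} (P : SimpleGraph (Fin n) → Prop) :
    MeasurableSet {p : (KEdge n → ℝ) × ℝ | P (thresholdGraph p.1 p.2)} := by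
  have h1 : ∀ H : SimpleGraph (Fin n),
      MeasurableSet {p : (KEdge n → ℝ) × ℝ | thresholdGraph p.1 p.2 = H} := by
    intro H
    have : {p : (KEdge n → ℝ) × ℝ | thresholdGraph p.1 p.2 = H} =
        ⋂ e : KEdge n, {p | p.1 e ≤ p.2 ↔ (e : Sym2 (Fin n)) ∈ H.edgeSet} := by
      ext p
      simp only [Set.mem_ofPred_eq, Set.mem_iInter]
      constructor
      · rintro rfl e
        exact (mem_edgeSet_thresholdGraph e).symm
      · intro h
        ext u v
        constructor
        · rintro ⟨huv, hx⟩
          exact (h (kedge u v huv)).1 hx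
        · intro hadj
          exact ⟨hadj.ne, (h (kedge u v hadj.ne)).2 hadj⟩
    rw [this]
    refine MeasurableSet.iInter fun e => ?_
    refine MeasurableSet.iff ?_ (MeasurableSet.const _)
    exact measurableSet_le (by fun_prop) measurable_snd
  have h2 : {p : (KEdge n → ℝ) × ℝ | P (thresholdGraph p.1 p.2)} =
      ⋃ H ∈ {H | P H}, {p | thresholdGraph p.1 p.2 = H} := by
    ext p
    simp
  rw [h2]
  exact MeasurableSet.biUnion (Set.toFinite _).countable fun H _ => h1 H

lemma measurable_comp_thresholdGraph {n : ℕ} {β : Type*} [MeasurableSpace β]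
    (f : SimpleGraph (Fin n) → β) :
    Measurable fun p : (KEdge n → ℝ) × ℝ => f (thresholdGraph p.1 p.2) :=
  fun s _ => measurableSet_thresholdGraph fun H => f H ∈ s

lemma measurableSet_thresholdGraph_at {n : ℕ} (P : SimpleGraph (Fin n) → Prop) (t : ℝ) :
    MeasurableSet {x : KEdge n → ℝ | P (thresholdGraph x t)} :=
  (measurableSet_thresholdGraph P).preimage (measurable_id.prodMk measurable_const)

section Independence

variable {ι : Type*} [Fintype ι] {α : ι → ℝ} [hα : Fact (∀ e, 0 < α e)]

lemma iIndepFun_expProduct (α : ι → ℝ) [hα : Fact (∀ e, 0 < α e)] :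
    iIndepFun (fun e x => x e) (expProduct α) := by
  have : ∀ e, IsProbabilityMeasure (expMeasure (α e)) :=
    fun e => isProbabilityMeasure_expMeasure (hα.out e)
  exact iIndepFun_pi (X := fun e (y : ℝ) => y) fun e => aemeasurable_id

/-- Events determined by disjoint sets of coordinates are independent. -/
lemma expProduct_real_inter {A B : Finset ι} (hAB : Disjoint A B) {U W : Set (ι → ℝ)}
    (hU : MeasurableSet U) (hW : MeasurableSet W)
    (hUA : DependsOn (· ∈ U) (A : Set ι)) (hWB : DependsOn (· ∈ W) (B : Set ι)) :
    (expProduct α).real (U ∩ W) = (expProduct α).real U * (expProduct α).real W := by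
  classical
  let ext : (D : Finset ι) → (D → ℝ) → ι → ℝ := fun D z e => if h : e ∈ D then z ⟨e, h⟩ else 0
  have hext : ∀ D, Measurable (ext D) := by
    intro D
    refine measurable_pi_lambda _ fun e => ?_
    by_cases h : e ∈ D
    · simp only [ext, h, dif_pos]
      exact measurable_pi_apply _
    · simp only [ext, h, dif_neg, not_false_eq_true]
      exact measurable_const
  have hpre : ∀ (D : Finset ι) (Y : Set (ι → ℝ)), DependsOn (· ∈ Y) (D : Set ι) →
      Y = (fun (x : ι → ℝ) (e : D) => x e) ⁻¹' (ext D ⁻¹' Y) := by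
    intro D Y hY
    ext x
    refine iff_of_eq (hY fun e he => ?_)
    have he' : e ∈ D := he
    simp [ext, he']
  have h := (iIndepFun_expProduct α).indepFun_finset A B hAB fun e => measurable_pi_apply e
  have h2 := h.measure_inter_preimage_eq_mul _ _ (hext A hU) (hext B hW)
  rw [← hpre A U hUA, ← hpre B W hWB] at h2
  rw [measureReal_def, h2, ENNReal.toReal_mul]
  rfl

lemma expProduct_real_le {e : ι} {t : ℝ} (ht : 0 ≤ t) :
    (expProduct α).real {x | x e ≤ t} = 1 - Real.exp (-(α e * t)) := by
  have : ∀ e, IsProbabilityMeasure (expMeasure (α e)) :=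
    fun e => isProbabilityMeasure_expMeasure (hα.out e)
  have h := cdf_expMeasure_eq (hα.out e) t
  rw [if_pos ht, cdf_eq_real] at h
  rw [← h]
  exact (measurePreserving_eval (fun e => expMeasure (α e)) e).measureReal_preimage
    measurableSet_Iic.nullMeasurableSet

lemma expProduct_real_gt {e : ι} {t : ℝ} (ht : 0 ≤ t) :
    (expProduct α).real {x | t < x e} = Real.exp (-(α e * t)) := by
  have h := expProduct_real_le (α := α) (e := e) ht
  have h2 : {x : ι → ℝ | t < x e} = {x | x e ≤ t}ᶜ := by
    ext x
    simp
  rw [h2, measureReal_compl (measurableSet_le (measurable_pi_apply e) measurable_const), h]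
  simp

/-- The joint law of the events `X_{f j} ≤ t` for distinct coordinates `f j`. -/
lemma expProduct_real_forall {J : Type*} [Fintype J] {f : J → ι} (hf : Function.Injective f)
    (b : J → Prop) [DecidablePred b] {t : ℝ} (ht : 0 ≤ t) :
    (expProduct α).real {x | ∀ j, x (f j) ≤ t ↔ b j} =
      ∏ j, if b j then 1 - Real.exp (-(α (f j) * t)) else Real.exp (-(α (f j) * t)) := by
  have h := ((iIndepFun_expProduct α).precomp hf).measure_inter_preimage_eq_mul Finset.univ
    (sets := fun j => if b j then Set.Iic t else Set.Ioi t) (fun j _ => by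
      split_ifs
      exacts [measurableSet_Iic, measurableSet_Ioi])
  have hset : {x : ι → ℝ | ∀ j, x (f j) ≤ t ↔ b j} = ⋂ j ∈ Finset.univ,
      (fun x : ι → ℝ => x (f j)) ⁻¹' (if b j then Set.Iic t else Set.Ioi t) := by
    ext x
    simp only [Set.mem_ofPred_eq, Finset.mem_univ, Set.iInter_true, Set.mem_iInter,
      Set.mem_preimage]
    refine forall_congr' fun j => ?_
    by_cases hb : b j <;> simp [hb]
  rw [hset, measureReal_def, h, ENNReal.toReal_prod]
  refine Finset.prod_congr rfl fun j _ => ?_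
  by_cases hb : b j
  · simp only [hb, if_true]
    exact expProduct_real_le ht
  · simp only [hb, if_false]
    exact expProduct_real_gt ht

end Independence

end Probability

/-! ### The probability that a set is reached from another -/

section Reach

open ProbabilityTheory

/-- Abel-type identity behind the exploration of one vertex. -/
lemma sum_powerset_pow_mul_sum {V : Type*} [DecidableEq V] (d : V → ℝ) (y z : ℝ) (S : Finset V) :
    (y + z) * ∑ B ∈ S.powerset, y ^ B.card * z ^ (S.card - B.card) * ∑ v ∈ B, d v =
      (∑ v ∈ S, d v) * y * (y + z) ^ S.card := by
  induction S using Finset.induction_on with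
  | empty => simp
  | insert a S ha ih =>
    rw [Finset.sum_powerset_insert ha]
    have h1 : ∀ B ∈ S.powerset, y ^ B.card * z ^ ((insert a S).card - B.card) * ∑ v ∈ B, d v =
        z * (y ^ B.card * z ^ (S.card - B.card) * ∑ v ∈ B, d v) := by
      intro B hB
      have hc := Finset.card_le_card (Finset.mem_powerset.1 hB)
      rw [Finset.card_insert_of_notMem ha, Nat.succ_sub hc, pow_succ]
      ring
    have h2 : ∀ B ∈ S.powerset, y ^ (insert a B).card * z ^ ((insert a S).card -
        (insert a B).card) * ∑ v ∈ insert a B, d v =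
        y * (y ^ B.card * z ^ (S.card - B.card) * ∑ v ∈ B, d v) +
        y * d a * (y ^ B.card * z ^ (S.card - B.card)) := by
      intro B hB
      have haB : a ∉ B := fun h => ha (Finset.mem_powerset.1 hB h)
      rw [Finset.card_insert_of_notMem ha, Finset.card_insert_of_notMem haB,
        Nat.add_sub_add_right, Finset.sum_insert haB]
      ring
    rw [Finset.sum_congr rfl h1, Finset.sum_congr rfl h2, Finset.sum_add_distrib,
      ← Finset.mul_sum, ← Finset.mul_sum, ← Finset.mul_sum, Finset.sum_pow_mul_eq_add_pow,
      Finset.sum_insert ha, Finset.card_insert_of_notMem ha]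
    linear_combination (y + z) * ih

/-- The leading term of the probability that `S` is reached from `R` inside `R ∪ S`. It is the
total weight, with weight `t d_v d_w` for the edge `vw`, of the forests on `R ∪ S` in which every
component contains exactly one vertex of `R`. The exponent `|S| - 1` of the total sum is written as
a quotient, so that the formula covers `S = ∅`. -/
noncomputable def reachWeight {V : Type*} (d : V → ℝ) (t : ℝ) (R S : Finset V) : ℝ :=
  t ^ S.card * (∏ v ∈ S, d v) *
    ((∑ v ∈ R, d v) * (∑ v ∈ R, d v + ∑ v ∈ S, d v) ^ S.card / (∑ v ∈ R, d v + ∑ v ∈ S, d v))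

lemma reachWeight_explore {V : Type*} [DecidableEq V] {d : V → ℝ} (hd : ∀ v, 0 < d v) (t : ℝ)
    {R S : Finset V} {r : V} (hr : r ∈ R) (hRS : Disjoint R S) (hS : S.Nonempty) :
    reachWeight d t R S = ∑ B ∈ S.powerset, (∏ s ∈ B, d r * d s * t) *
      reachWeight d t (R.erase r ∪ B) (S \ B) := by
  set ρ := ∑ v ∈ R.erase r, d v with hρ
  have hρ0 : 0 ≤ ρ := Finset.sum_nonneg fun v _ => (hd v).le
  have hR : ∑ v ∈ R, d v = d r + ρ := (Finset.add_sum_erase R d hr).symm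
  have hS0 : 0 < ∑ v ∈ S, d v := Finset.sum_pos (fun v _ => hd v) hS
  set σ := ∑ v ∈ S, d v with hσ
  have hz : 0 < ρ + σ := by linarith
  have hyz : 0 < d r + (ρ + σ) := by linarith [hd r]
  have hterm : ∀ B ∈ S.powerset, (∏ s ∈ B, d r * d s * t) *
      reachWeight d t (R.erase r ∪ B) (S \ B) = t ^ S.card * (∏ v ∈ S, d v) / (ρ + σ) *
        (ρ * (d r ^ B.card * (ρ + σ) ^ (S.card - B.card)) +
          d r ^ B.card * (ρ + σ) ^ (S.card - B.card) * ∑ v ∈ B, d v) := by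
    intro B hB
    have hBS := Finset.mem_powerset.1 hB
    have hdis : Disjoint (R.erase r) B :=
      (hRS.mono_left (Finset.erase_subset _ _)).mono_right hBS
    have h1 : ∑ v ∈ R.erase r ∪ B, d v = ρ + ∑ v ∈ B, d v := Finset.sum_union hdis
    have h2 : ∑ v ∈ S \ B, d v + ∑ v ∈ B, d v = σ := Finset.sum_sdiff hBS
    have h3 : (∏ v ∈ S \ B, d v) * ∏ v ∈ B, d v = ∏ v ∈ S, d v := Finset.prod_sdiff hBS
    have h4 : ρ + ∑ v ∈ B, d v + ∑ v ∈ S \ B, d v = ρ + σ := by linarith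
    have h5 : t ^ S.card = t ^ (S.card - B.card) * t ^ B.card := by
      rw [← pow_add, Nat.sub_add_cancel (Finset.card_le_card hBS)]
    rw [reachWeight, h1, h4, Finset.card_sdiff_of_subset hBS, ← h3, h5, Finset.prod_mul_distrib,
      Finset.prod_mul_distrib, Finset.prod_const, Finset.prod_const]
    ring
  rw [Finset.sum_congr rfl hterm, ← Finset.mul_sum, Finset.sum_add_distrib, ← Finset.mul_sum,
    Finset.sum_pow_mul_eq_add_pow]
  have habel := sum_powerset_pow_mul_sum d (d r) (ρ + σ) S
  rw [← hσ] at habel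
  rw [reachWeight, hR, ← hσ]
  have habel' : ∑ B ∈ S.powerset, d r ^ B.card * (ρ + σ) ^ (S.card - B.card) * ∑ v ∈ B, d v =
      σ * d r * (d r + (ρ + σ)) ^ S.card / (d r + (ρ + σ)) := by
    rw [eq_div_iff hyz.ne', mul_comm, habel]
  rw [habel', show d r + ρ + σ = d r + (ρ + σ) by ring]
  field_simp
  ring

variable {n : ℕ} {α : KEdge n → ℝ} {d : Fin n → ℝ}

lemma exists_eq_kedge (e : KEdge n) : ∃ u v, ∃ h : u ≠ v, e = kedge u v h := by
  obtain ⟨e, he⟩ := e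
  induction e using Sym2.ind with | _ u v
  exact ⟨u, v, by simpa using he, rfl⟩

lemma IsDecomposition.pos (hα : IsDecomposition α d) (hd : ∀ v, 0 < d v) (e : KEdge n) :
    0 < α e := by
  obtain ⟨u, v, h, rfl⟩ := exists_eq_kedge e
  rw [hα]
  exact mul_pos (hd u) (hd v)

lemma mem_kedge {u v w : Fin n} (h : u ≠ v) :
    w ∈ (kedge u v h : Sym2 (Fin n)) ↔ w = u ∨ w = v := Sym2.mem_iff

lemma ReachedWithin.congr {V : Type*} [DecidableEq V] {G H : SimpleGraph V} {R S : Finset V}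
    (h : ∀ u ∈ R ∪ S, ∀ w ∈ R ∪ S, G.Adj u w ↔ H.Adj u w) :
    ReachedWithin G R S ↔ ReachedWithin H R S := by
  refine forall_congr' fun U => forall_congr' fun hU => forall_congr' fun _ => ?_
  refine exists_congr fun u => and_congr_right fun hu => exists_congr fun w =>
    and_congr_right fun hw => ?_
  exact h u (Finset.mem_union_right _ (hU hu)) w (Finset.mem_sdiff.1 hw).1

/-- The probability that `S` is reached from `R` inside `R ∪ S` at time `t`. -/
noncomputable def reachProb (α : KEdge n → ℝ) (t : ℝ) (R S : Finset (Fin n)) : ℝ :=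
  (expProduct α).real {x | ReachedWithin (thresholdGraph x t) R S}

lemma thresholdGraph_adj_congr {x y : KEdge n → ℝ} {t : ℝ} {u w : Fin n}
    (h : ∀ huw : u ≠ w, x (kedge u w huw) = y (kedge u w huw)) :
    (thresholdGraph x t).Adj u w ↔ (thresholdGraph y t).Adj u w :=
  exists_congr fun huw => by rw [h huw]

lemma dependsOn_reachedWithin (t : ℝ) (R S : Finset (Fin n)) (A : Set (KEdge n))
    (hA : ∀ e : KEdge n, (∀ v ∈ (e : Sym2 (Fin n)), v ∈ R ∪ S) → e ∈ A) :
    DependsOn (· ∈ {x : KEdge n → ℝ | ReachedWithin (thresholdGraph x t) R S}) A := by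
  intro x y hxy
  refine propext (ReachedWithin.congr fun u hu w hw => ?_)
  refine thresholdGraph_adj_congr fun huw => hxy _ (hA _ fun v hv => ?_)
  rcases (mem_kedge huw).1 hv with rfl | rfl
  exacts [hu, hw]

/-- The law of the neighbourhood of `r` in `S`. -/
lemma expProduct_real_neighbors [Fact (∀ e, 0 < α e)] (hα : IsDecomposition α d) {t : ℝ}
    (ht : 0 ≤ t) {S B : Finset (Fin n)} {r : Fin n} (hrS : r ∉ S) (hB : B ⊆ S) :
    (expProduct α).real {x | ∀ s ∈ S, (thresholdGraph x t).Adj r s ↔ s ∈ B} =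
      (∏ s ∈ B, (1 - Real.exp (-(d r * d s * t)))) *
        ∏ s ∈ S \ B, Real.exp (-(d r * d s * t)) := by
  have hne : ∀ s : S, r ≠ s := fun s h => hrS (h ▸ s.2)
  have hinj : Function.Injective fun s : S => kedge r s (hne s) := by
    intro s s' h
    have h1 := congrArg Subtype.val h
    exact Subtype.ext (Sym2.congr_right.1 h1)
  have hset : {x : KEdge n → ℝ | ∀ s ∈ S, (thresholdGraph x t).Adj r s ↔ s ∈ B} =
      {x | ∀ s : S, x (kedge r s (hne s)) ≤ t ↔ (s : Fin n) ∈ B} := by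
    ext x
    simp only [Set.mem_ofPred_eq, Subtype.forall]
    refine forall_congr' fun s => forall_congr' fun hs => ?_
    refine iff_congr ⟨fun ⟨_, h⟩ => h, fun h => ⟨_, h⟩⟩ Iff.rfl
  rw [hset, expProduct_real_forall hinj _ ht]
  simp only [hα r _ (hne _)]
  rw [Finset.prod_coe_sort S (fun s => if s ∈ B then 1 - Real.exp (-(d r * d s * t)) else
    Real.exp (-(d r * d s * t))), Finset.prod_ite, Finset.filter_mem_eq_inter,
    Finset.inter_eq_right.2 hB, Finset.filter_notMem_eq_sdiff]

lemma reachProb_explore [Fact (∀ e, 0 < α e)] (hα : IsDecomposition α d) {t : ℝ} (ht : 0 ≤ t)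
    {R S : Finset (Fin n)} {r : Fin n} (hr : r ∈ R) (hRS : Disjoint R S) :
    reachProb α t R S = ∑ B ∈ S.powerset, ((∏ s ∈ B, (1 - Real.exp (-(d r * d s * t)))) *
      ∏ s ∈ S \ B, Real.exp (-(d r * d s * t))) * reachProb α t (R.erase r ∪ B) (S \ B) := by
  classical
  have hrS : r ∉ S := Finset.disjoint_left.1 hRS hr
  let N : Finset (Fin n) → Set (KEdge n → ℝ) :=
    fun B => {x | ∀ s ∈ S, (thresholdGraph x t).Adj r s ↔ s ∈ B}
  let E : Finset (Fin n) → Finset (Fin n) → Set (KEdge n → ℝ) :=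
    fun R S => {x | ReachedWithin (thresholdGraph x t) R S}
  have hN : ∀ B, MeasurableSet (N B) := fun B =>
    measurableSet_thresholdGraph_at (fun G => ∀ s ∈ S, G.Adj r s ↔ s ∈ B) t
  have hE : ∀ R S, MeasurableSet (E R S) := fun R S =>
    measurableSet_thresholdGraph_at (fun G => ReachedWithin G R S) t
  have hunion : E R S = ⋃ B ∈ S.powerset, N B ∩ E (R.erase r ∪ B) (S \ B) := by
    ext x
    simp only [Set.mem_iUnion, Finset.mem_powerset, Set.mem_inter_iff, exists_prop]
    constructor
    · intro hx
      have hNB : ∀ s ∈ S, (thresholdGraph x t).Adj r s ↔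
          s ∈ S.filter fun s => (thresholdGraph x t).Adj r s := by
        intro s hs
        simp [hs]
      exact ⟨_, Finset.filter_subset _ _, hNB,
        (reachedWithin_iff_explore hr hrS (Finset.filter_subset _ _) hNB).1 hx⟩
    · rintro ⟨B, hB, hNB, hx⟩
      exact (reachedWithin_iff_explore hr hrS hB hNB).2 hx
  have hdisj : (S.powerset : Set (Finset (Fin n))).PairwiseDisjoint
      fun B => N B ∩ E (R.erase r ∪ B) (S \ B) := by
    intro B hB B' hB' hne
    refine Set.disjoint_left.2 fun x hx hx' => hne ?_
    ext s
    have hB1 := Finset.mem_powerset.1 hB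
    have hB2 := Finset.mem_powerset.1 hB'
    exact ⟨fun h => (hx'.1 s (hB1 h)).1 ((hx.1 s (hB1 h)).2 h),
      fun h => (hx.1 s (hB2 h)).1 ((hx'.1 s (hB2 h)).2 h)⟩
  change (expProduct α).real (E R S) = _
  rw [hunion, measureReal_biUnion_finset hdisj fun B _ => (hN B).inter (hE _ _)]
  refine Finset.sum_congr rfl fun B hB => ?_
  have hBS := Finset.mem_powerset.1 hB
  rw [← expProduct_real_neighbors hα ht hrS hBS]
  -- the neighbourhood of `r` depends on the edges at `r`, the rest on the other edges
  refine expProduct_real_inter (A := Finset.univ.filter fun e : KEdge n => r ∈ (e : Sym2 (Fin n)))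
    (B := Finset.univ.filter fun e : KEdge n => r ∉ (e : Sym2 (Fin n)))
    (Finset.disjoint_filter_filter_not _ _ _) (hN B) (hE _ _) ?_ ?_
  · intro x y hxy
    refine propext (forall_congr' fun s => forall_congr' fun _ => iff_congr ?_ Iff.rfl)
    refine thresholdGraph_adj_congr fun h => hxy _ ?_
    simp [mem_kedge]
  · refine dependsOn_reachedWithin t _ _ _ fun e he => ?_
    rw [Finset.mem_coe, Finset.mem_filter]
    refine ⟨Finset.mem_univ _, fun hre => ?_⟩
    have := he r hre
    simp only [Finset.mem_union, Finset.mem_erase, Finset.mem_sdiff] at this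
    have h2 := fun h => hrS (hBS h)
    tauto

lemma reachProb_nonneg (t : ℝ) (R S : Finset (Fin n)) : 0 ≤ reachProb α t R S :=
  measureReal_nonneg

lemma reachWeight_nonneg {V : Type*} {d : V → ℝ} (hd : ∀ v, 0 < d v) {t : ℝ} (ht : 0 ≤ t)
    (R S : Finset V) : 0 ≤ reachWeight d t R S := by
  have h1 : 0 ≤ ∑ v ∈ R, d v := Finset.sum_nonneg fun v _ => (hd v).le
  have h2 : 0 ≤ ∑ v ∈ S, d v := Finset.sum_nonneg fun v _ => (hd v).le
  have h3 : 0 ≤ ∏ v ∈ S, d v := Finset.prod_nonneg fun v _ => (hd v).le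
  unfold reachWeight
  positivity

/-- The probability that `S` is reached from `R`, up to an exponential factor that accounts for
the absence of superfluous edges. -/
theorem reachProb_bounds [Fact (∀ e, 0 < α e)] (hα : IsDecomposition α d) (hd : ∀ v, 0 < d v)
    {t : ℝ} (ht : 0 ≤ t) {R S : Finset (Fin n)} (hRS : Disjoint R S) (hne : (R ∪ S).Nonempty) :
    Real.exp (-(t * (∑ v ∈ R, d v + ∑ v ∈ S, d v) * ∑ v ∈ S, d v)) * reachWeight d t R S ≤
      reachProb α t R S ∧ reachProb α t R S ≤ reachWeight d t R S := by
  induction hm : R.card + S.card generalizing R S with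
  | zero =>
    rw [Nat.add_eq_zero_iff, Finset.card_eq_zero, Finset.card_eq_zero] at hm
    simp [hm.1, hm.2] at hne
  | succ m ih =>
    rcases S.eq_empty_or_nonempty with rfl | hS
    · rw [Finset.union_empty] at hne
      have h1 : reachProb α t R ∅ = 1 := by
        simp [reachProb, reachedWithin_empty_right]
      have h2 : reachWeight d t R ∅ = 1 := by
        have : 0 < ∑ v ∈ R, d v := Finset.sum_pos (fun v _ => hd v) hne
        simp [reachWeight, this.ne']
      simp [h1, h2]
    rcases R.eq_empty_or_nonempty with rfl | ⟨r, hr⟩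
    · have h1 : reachProb α t ∅ S = 0 := by
        simp [reachProb, not_reachedWithin_empty_left _ hS]
      have h2 : reachWeight d t ∅ S = 0 := by simp [reachWeight]
      simp [h1, h2]
    have hcase : ∀ B ∈ S.powerset,
        Real.exp (-(t * (∑ v ∈ R.erase r ∪ B, d v + ∑ v ∈ S \ B, d v) * ∑ v ∈ S \ B, d v)) *
          reachWeight d t (R.erase r ∪ B) (S \ B) ≤ reachProb α t (R.erase r ∪ B) (S \ B) ∧
        reachProb α t (R.erase r ∪ B) (S \ B) ≤ reachWeight d t (R.erase r ∪ B) (S \ B) := by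
      intro B hB
      have hBS := Finset.mem_powerset.1 hB
      have hdis : Disjoint (R.erase r) S := hRS.mono_left (Finset.erase_subset _ _)
      refine ih ?_ ?_ ?_
      · rw [Finset.disjoint_union_left]
        exact ⟨hdis.mono_right Finset.sdiff_subset, Finset.disjoint_sdiff⟩
      · obtain ⟨s, hs⟩ := hS
        refine ⟨s, ?_⟩
        simp only [Finset.mem_union, Finset.mem_sdiff]
        tauto
      · rw [Finset.card_union_of_disjoint (hdis.mono_right hBS), Finset.card_erase_of_mem hr,
          Finset.card_sdiff_of_subset hBS]
        have := Finset.card_le_card hBS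
        have := Finset.card_pos.2 ⟨r, hr⟩
        omega
    have hx : ∀ s, 0 ≤ d r * d s * t := fun s =>
      mul_nonneg (mul_pos (hd r) (hd s)).le ht
    have hp0 : ∀ s, 0 ≤ 1 - Real.exp (-(d r * d s * t)) := fun s => by
      have := Real.exp_le_one_iff.2 (neg_nonpos.2 (hx s))
      linarith
    rw [reachProb_explore hα ht hr hRS, reachWeight_explore hd t hr hRS hS, Finset.mul_sum]
    constructor
    · refine Finset.sum_le_sum fun B hB => ?_
      have hBS := Finset.mem_powerset.1 hB
      have hw := reachWeight_nonneg hd ht (R.erase r ∪ B) (S \ B)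
      have hdis : Disjoint (R.erase r) B :=
        (hRS.mono_left (Finset.erase_subset _ _)).mono_right hBS
      have hpr : 0 ≤ ∏ s ∈ B, d r * d s * t := Finset.prod_nonneg fun s _ => hx s
      -- `1 - e^{-x} ≥ x e^{-x}` for each neighbour
      have h1 : (∏ s ∈ B, d r * d s * t) * Real.exp (-(t * d r * ∑ v ∈ S, d v)) ≤
          (∏ s ∈ B, (1 - Real.exp (-(d r * d s * t)))) *
            ∏ s ∈ S \ B, Real.exp (-(d r * d s * t)) := by
        have h2 : Real.exp (-(t * d r * ∑ v ∈ S, d v)) =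
            (∏ s ∈ B, Real.exp (-(d r * d s * t))) *
              ∏ s ∈ S \ B, Real.exp (-(d r * d s * t)) := by
          rw [mul_comm (∏ s ∈ B, _), Finset.prod_sdiff hBS, ← Real.exp_sum, Finset.mul_sum,
            ← Finset.sum_neg_distrib]
          congr 1
          exact Finset.sum_congr rfl fun s _ => by ring
        rw [h2, ← mul_assoc, ← Finset.prod_mul_distrib]
        refine mul_le_mul_of_nonneg_right ?_ (Finset.prod_nonneg fun s _ => (Real.exp_pos _).le)
        refine Finset.prod_le_prod (fun s _ => mul_nonneg (hx s) (Real.exp_pos _).le) fun s _ => ?_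
        have h3 := Real.add_one_le_exp (d r * d s * t)
        have h4 : Real.exp (d r * d s * t) * Real.exp (-(d r * d s * t)) = 1 := by
          rw [← Real.exp_add, add_neg_cancel, Real.exp_zero]
        nlinarith [Real.exp_pos (-(d r * d s * t))]
      have hR : ∑ v ∈ R, d v = d r + ∑ v ∈ R.erase r, d v := (Finset.add_sum_erase R d hr).symm
      have hσ : ∑ v ∈ S \ B, d v + ∑ v ∈ B, d v = ∑ v ∈ S, d v := Finset.sum_sdiff hBS
      have hB0 : 0 ≤ ∑ v ∈ B, d v := Finset.sum_nonneg fun v _ => (hd v).le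
      have hS0 : 0 ≤ ∑ v ∈ S, d v := Finset.sum_nonneg fun v _ => (hd v).le
      have hR0 : 0 ≤ ∑ v ∈ R.erase r, d v := Finset.sum_nonneg fun v _ => (hd v).le
      have h5 : Real.exp (-(t * (∑ v ∈ R, d v + ∑ v ∈ S, d v) * ∑ v ∈ S, d v)) ≤
          Real.exp (-(t * d r * ∑ v ∈ S, d v)) *
          Real.exp (-(t * (∑ v ∈ R.erase r ∪ B, d v + ∑ v ∈ S \ B, d v) *
            ∑ v ∈ S \ B, d v)) := by
        rw [← Real.exp_add, Real.exp_le_exp, Finset.sum_union hdis, hR]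
        have h6 : ∑ v ∈ S \ B, d v = ∑ v ∈ S, d v - ∑ v ∈ B, d v := by linarith
        rw [h6]
        have h7 : 0 ≤ t * (∑ v ∈ R.erase r, d v + ∑ v ∈ S, d v) * ∑ v ∈ B, d v := by positivity
        nlinarith
      calc _ ≤ (Real.exp (-(t * d r * ∑ v ∈ S, d v)) *
          Real.exp (-(t * (∑ v ∈ R.erase r ∪ B, d v + ∑ v ∈ S \ B, d v) *
            ∑ v ∈ S \ B, d v))) * ((∏ s ∈ B, d r * d s * t) *
            reachWeight d t (R.erase r ∪ B) (S \ B)) :=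
            mul_le_mul_of_nonneg_right h5 (mul_nonneg hpr hw)
        _ = ((∏ s ∈ B, d r * d s * t) * Real.exp (-(t * d r * ∑ v ∈ S, d v))) *
          (Real.exp (-(t * (∑ v ∈ R.erase r ∪ B, d v + ∑ v ∈ S \ B, d v) *
            ∑ v ∈ S \ B, d v)) * reachWeight d t (R.erase r ∪ B) (S \ B)) := by ring
        _ ≤ _ := mul_le_mul h1 (hcase B hB).1 (mul_nonneg (Real.exp_pos _).le hw)
            (mul_nonneg (Finset.prod_nonneg fun s _ => hp0 s)
              (Finset.prod_nonneg fun s _ => (Real.exp_pos _).le))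
    · refine Finset.sum_le_sum fun B hB => ?_
      refine mul_le_mul ?_ (hcase B hB).2 (reachProb_nonneg _ _ _)
        (Finset.prod_nonneg fun s _ => hx s)
      rw [← mul_one (∏ s ∈ B, d r * d s * t)]
      refine mul_le_mul (Finset.prod_le_prod (fun s _ => hp0 s) fun s _ => ?_)
        (Finset.prod_le_one (fun s _ => (Real.exp_pos _).le) fun s _ =>
          Real.exp_le_one_iff.2 (neg_nonpos.2 (hx s)))
        (Finset.prod_nonneg fun s _ => (Real.exp_pos _).le)
        (Finset.prod_nonneg fun s _ => hx s)
      have := Real.add_one_le_exp (-(d r * d s * t))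
      linarith

end Reach

/-! ### The probability that a set is a component -/

section ComponentProbability

open ProbabilityTheory

variable {n : ℕ} {α : KEdge n → ℝ} {d : Fin n → ℝ}

lemma expProduct_real_isClosedSet [Fact (∀ e, 0 < α e)] (hα : IsDecomposition α d) {t : ℝ}
    (ht : 0 ≤ t) (C : Finset (Fin n)) :
    (expProduct α).real {x | IsClosedSet (thresholdGraph x t) C} =
      Real.exp (-(t * (∑ v ∈ C, d v) * ∑ v ∈ Cᶜ, d v)) := by
  have hne : ∀ p : (C ×ˢ Cᶜ : Finset (Fin n × Fin n)), p.1.1 ≠ p.1.2 := by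
    rintro ⟨⟨u, w⟩, hp⟩ (rfl : u = w)
    rw [Finset.mem_product, Finset.mem_compl] at hp
    exact hp.2 hp.1
  have hinj : Function.Injective fun p : (C ×ˢ Cᶜ : Finset (Fin n × Fin n)) =>
      kedge p.1.1 p.1.2 (hne p) := by
    rintro ⟨⟨u, w⟩, hp⟩ ⟨⟨u', w'⟩, hp'⟩ h
    have h1 : s(u, w) = s(u', w') := congrArg Subtype.val h
    rw [Finset.mem_product, Finset.mem_compl] at hp hp'
    rcases Sym2.eq_iff.1 h1 with ⟨rfl, rfl⟩ | ⟨rfl, rfl⟩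
    · rfl
    · exact absurd hp.1 hp'.2
  have hset : {x : KEdge n → ℝ | IsClosedSet (thresholdGraph x t) C} =
      {x | ∀ p : (C ×ˢ Cᶜ : Finset (Fin n × Fin n)),
        x (kedge p.1.1 p.1.2 (hne p)) ≤ t ↔ False} := by
    ext x
    simp only [Set.mem_ofPred_eq, iff_false]
    constructor
    · rintro h ⟨⟨u, w⟩, hp⟩ hx
      have hp' := hp
      rw [Finset.mem_product, Finset.mem_compl] at hp'
      exact h u hp'.1 w hp'.2 ⟨_, hx⟩
    · rintro h u hu w hw ⟨huw, hx⟩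
      exact h ⟨(u, w), Finset.mem_product.2 ⟨hu, Finset.mem_compl.2 hw⟩⟩ hx
  rw [hset, expProduct_real_forall hinj (fun _ => False) ht]
  simp only [if_false, hα _ _ (hne _)]
  rw [Finset.prod_coe_sort (C ×ˢ Cᶜ) (fun p => Real.exp (-(d p.1 * d p.2 * t))), ← Real.exp_sum,
    Finset.sum_neg_distrib, ← Finset.sum_mul, Finset.sum_product]
  simp only [← Finset.mul_sum, ← Finset.sum_mul]
  congr 1
  ring

/-- The total weight of the trees on the vertex set `C`, when the edge `vw` has weight
`d_v d_w`. -/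
noncomputable def treeWeight {V : Type*} (d : V → ℝ) (C : Finset V) : ℝ :=
  (∏ v ∈ C, d v) * ((∑ v ∈ C, d v) ^ C.card / (∑ v ∈ C, d v) ^ 2)

/-- The probability that `C` is a component, up to a factor close to one while `t d_C²` is small. -/
theorem component_bounds [Fact (∀ e, 0 < α e)] (hα : IsDecomposition α d) (hd : ∀ v, 0 < d v)
    {t : ℝ} (ht : 0 ≤ t) {C : Finset (Fin n)} (hC : C.Nonempty) :
    treeWeight d C * (t ^ (C.card - 1) * Real.exp (-(t * ((∑ v ∈ C, d v) * ∑ v, d v)))) ≤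
      (expProduct α).real {x | IsComponentSet (thresholdGraph x t) C} ∧
    (expProduct α).real {x | IsComponentSet (thresholdGraph x t) C} ≤
      Real.exp (t * (∑ v ∈ C, d v) ^ 2) * (treeWeight d C *
        (t ^ (C.card - 1) * Real.exp (-(t * ((∑ v ∈ C, d v) * ∑ v, d v))))) := by
  classical
  obtain ⟨v, hv⟩ := hC
  have hins : {v} ∪ C.erase v = C := by
    rw [← Finset.insert_eq, Finset.insert_erase hv]
  have hset : {x : KEdge n → ℝ | IsComponentSet (thresholdGraph x t) C} =
      {x | ReachedWithin (thresholdGraph x t) {v} (C.erase v)} ∩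
        {x | IsClosedSet (thresholdGraph x t) C} := by
    ext x
    exact isComponentSet_iff hv
  have hind := expProduct_real_inter (α := α)
    (A := Finset.univ.filter fun e : KEdge n => ∀ w ∈ (e : Sym2 (Fin n)), w ∈ C)
    (B := Finset.univ.filter fun e : KEdge n => ¬ ∀ w ∈ (e : Sym2 (Fin n)), w ∈ C)
    (Finset.disjoint_filter_filter_not _ _ _)
    (measurableSet_thresholdGraph_at (fun G => ReachedWithin G {v} (C.erase v)) t)
    (measurableSet_thresholdGraph_at (fun G => IsClosedSet G C) t)
    (dependsOn_reachedWithin t _ _ _ fun e he => by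
      rw [hins] at he
      simpa using he)
    (by
      intro x y hxy
      refine propext (forall_congr' fun u => forall_congr' fun hu => forall_congr' fun w =>
        forall_congr' fun hw => not_congr ?_)
      refine thresholdGraph_adj_congr fun h => hxy _ ?_
      rw [Finset.mem_coe, Finset.mem_filter]
      refine ⟨Finset.mem_univ _, fun hall => hw (hall w ?_)⟩
      simp [mem_kedge])
  have hdis : Disjoint {v} (C.erase v) := by simp
  obtain ⟨hlo, hup⟩ := reachProb_bounds hα hd ht hdis ⟨v, by simp⟩
  have hsum : ∑ w ∈ {v}, d w + ∑ w ∈ C.erase v, d w = ∑ w ∈ C, d w := by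
    rw [Finset.sum_singleton, Finset.add_sum_erase C d hv]
  set σ := ∑ w ∈ C, d w with hσ
  have hσ0 : 0 < σ := Finset.sum_pos (fun w _ => hd w) ⟨v, hv⟩
  have hrw : reachWeight d t {v} (C.erase v) = treeWeight d C * t ^ (C.card - 1) := by
    rw [reachWeight, hsum, Finset.sum_singleton, Finset.card_erase_of_mem hv, treeWeight, ← hσ,
      ← Finset.mul_prod_erase C d hv]
    obtain ⟨k, hk⟩ : ∃ k, C.card = k + 1 := Nat.exists_eq_succ_of_ne_zero
      (Finset.card_pos.2 ⟨v, hv⟩).ne'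
    rw [hk, Nat.add_sub_cancel, pow_succ σ k]
    field_simp
  have hD : ∑ w ∈ Cᶜ, d w = ∑ w, d w - σ := by
    rw [← Finset.sum_add_sum_compl C d]
    ring
  have hw0 : 0 ≤ treeWeight d C * t ^ (C.card - 1) := hrw ▸ reachWeight_nonneg hd ht _ _
  rw [hset, hind, expProduct_real_isClosedSet hα ht, hD, ← hσ]
  rw [hsum, hrw] at hlo
  rw [hrw] at hup
  change _ ≤ reachProb α t {v} (C.erase v) * _ ∧ reachProb α t {v} (C.erase v) * _ ≤ _
  constructor
  · have hsplit : treeWeight d C * (t ^ (C.card - 1) * Real.exp (-(t * (σ * ∑ v, d v)))) =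
        (Real.exp (-(t * σ * σ)) * (treeWeight d C * t ^ (C.card - 1))) *
          Real.exp (-(t * σ * (∑ w, d w - σ))) := by
      rw [mul_right_comm, ← Real.exp_add, mul_comm (Real.exp _), mul_assoc]
      congr 3
      ring
    rw [hsplit]
    refine mul_le_mul_of_nonneg_right (le_trans ?_ hlo) (Real.exp_pos _).le
    refine mul_le_mul_of_nonneg_right (Real.exp_le_exp.2 ?_) hw0
    have h1 : ∑ w ∈ C.erase v, d w ≤ σ :=
      Finset.sum_le_sum_of_subset_of_nonneg (Finset.erase_subset _ _) fun w _ _ => (hd w).le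
    have := mul_le_mul_of_nonneg_left h1 (mul_nonneg ht hσ0.le)
    linarith
  · refine (mul_le_mul_of_nonneg_right hup (Real.exp_pos _).le).trans (le_of_eq ?_)
    rw [mul_left_comm, mul_assoc (treeWeight d C)]
    congr 1
    rw [mul_left_comm, ← Real.exp_add]
    congr 2
    ring

end ComponentProbability

/-! ### Integration over the threshold -/

section TimeIntegral

open ProbabilityTheory

variable {n : ℕ} {α : KEdge n → ℝ} {d : Fin n → ℝ}

lemma ae_nonneg_expProduct [hα : Fact (∀ e, 0 < α e)] : ∀ᵐ x ∂expProduct α, ∀ e, 0 ≤ x e := by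
  rw [ae_all_iff]
  intro e
  have h := expProduct_real_le (α := α) (e := e) le_rfl
  rw [mul_zero, neg_zero, Real.exp_zero, sub_self, measureReal_eq_zero_iff] at h
  filter_upwards [measure_eq_zero_iff_ae_notMem.1 h] with x hx
  exact (not_le.1 hx).le

open Classical in
lemma lintegral_card_filter [Fact (∀ e, 0 < α e)]
    (P : SimpleGraph (Fin n) → Finset (Fin n) → Prop) (s : Finset (Finset (Fin n))) (t : ℝ) :
    ∫⁻ x, ((s.filter fun C => P (thresholdGraph x t) C).card : ENNReal) ∂expProduct α =
      ∑ C ∈ s, ENNReal.ofReal ((expProduct α).real {x | P (thresholdGraph x t) C}) := by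
  have hmeas : ∀ C, MeasurableSet {x : KEdge n → ℝ | P (thresholdGraph x t) C} := fun C =>
    measurableSet_thresholdGraph_at (fun G => P G C) t
  have h1 : ∀ x : KEdge n → ℝ, ((s.filter fun C => P (thresholdGraph x t) C).card : ENNReal) =
      ∑ C ∈ s, {x : KEdge n → ℝ | P (thresholdGraph x t) C}.indicator
        (1 : (KEdge n → ℝ) → ENNReal) x := by
    intro x
    rw [Finset.card_filter, Nat.cast_sum]
    refine Finset.sum_congr rfl fun C _ => ?_
    by_cases h : P (thresholdGraph x t) C <;> simp [h]
  simp_rw [h1]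
  rw [lintegral_finsetSum _ fun C _ => measurable_one.indicator (hmeas C)]
  refine Finset.sum_congr rfl fun C _ => ?_
  rw [lintegral_indicator_one (hmeas C), ofReal_measureReal]

/-- The expected minimum spanning tree weight as an integral over the threshold. -/
lemma lintegral_mstWeight_eq [Fact (∀ e, 0 < α e)] (hn : 0 < n) :
    ∫⁻ x, ENNReal.ofReal (mstWeight x) ∂expProduct α = ∫⁻ t in Set.Ioi (0 : ℝ), ∫⁻ x,
      ((Nat.card (thresholdGraph x t).ConnectedComponent - 1 : ℕ) : ENNReal) ∂expProduct α := by
  rw [lintegral_congr_ae (ae_nonneg_expProduct.mono fun x hx => ofReal_mstWeight hn hx)]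
  exact lintegral_lintegral_swap (measurable_comp_thresholdGraph (n := n)
    (fun G => ((Nat.card G.ConnectedComponent - 1 : ℕ) : ENNReal))).aemeasurable

/-- The nonempty vertex sets with at most `K` elements, the candidates for small components. -/
def smallVertexSets (n K : ℕ) : Finset (Finset (Fin n)) :=
  Finset.univ.filter fun C => C.Nonempty ∧ C.card ≤ K

/-- The nonempty vertex sets with at most half of the vertices. -/
def halfVertexSets (n : ℕ) : Finset (Finset (Fin n)) :=
  Finset.univ.filter fun C => C.Nonempty ∧ 2 * C.card ≤ n

open Classical in
lemma card_connectedComponent_eq_small_add (G : SimpleGraph (Fin n)) (K : ℕ) :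
    Nat.card G.ConnectedComponent = ((smallVertexSets n K).filter fun C => IsComponentSet G C).card +
      (Finset.univ.filter fun C : Finset (Fin n) => IsComponentSet G C ∧ K < C.card).card := by
  rw [card_connectedComponent_eq_add G K]
  congr 2
  ext C
  simp only [Finset.mem_filter, Finset.mem_univ, true_and, smallVertexSets]
  exact ⟨fun h => ⟨⟨h.1.nonempty, h.2⟩, h.1⟩, fun h => ⟨h.2, h.1.2⟩⟩

lemma sum_component_le [Fact (∀ e, 0 < α e)] (hn : 0 < n) (K : ℕ) (t : ℝ) :
    ∑ C ∈ smallVertexSets n K,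
        ENNReal.ofReal ((expProduct α).real {x | IsComponentSet (thresholdGraph x t) C}) ≤
      ∫⁻ x, ((Nat.card (thresholdGraph x t).ConnectedComponent - 1 : ℕ) : ENNReal)
        ∂expProduct α + 1 := by
  classical
  rw [← lintegral_card_filter]
  calc _ ≤ ∫⁻ x, (((Nat.card (thresholdGraph x t).ConnectedComponent - 1 : ℕ) : ENNReal) + 1)
        ∂expProduct α := by
        refine lintegral_mono fun x => ?_
        have h1 := card_connectedComponent_eq_small_add (thresholdGraph x t) K
        have h2 := one_le_card_connectedComponent hn (thresholdGraph x t)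
        rw [← Nat.cast_add_one]
        exact Nat.cast_le.2 (by omega)
    _ = _ := by
        rw [lintegral_add_right _ measurable_const, lintegral_one, measure_univ]

lemma lintegral_card_sub_one_le [Fact (∀ e, 0 < α e)] {K : ℕ} (hK : 0 < K) (t : ℝ) :
    ∫⁻ x, ((Nat.card (thresholdGraph x t).ConnectedComponent - 1 : ℕ) : ENNReal)
        ∂expProduct α ≤ ∑ C ∈ smallVertexSets n K,
        ENNReal.ofReal ((expProduct α).real {x | IsComponentSet (thresholdGraph x t) C}) +
      ENNReal.ofReal ((n : ℝ) / K) := by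
  classical
  rw [← lintegral_card_filter]
  calc _ ≤ ∫⁻ x, ((((smallVertexSets n K).filter fun C =>
      IsComponentSet (thresholdGraph x t) C).card : ENNReal) +
        ENNReal.ofReal ((n : ℝ) / K)) ∂expProduct α := by
        refine lintegral_mono fun x => ?_
        have h1 := card_connectedComponent_eq_small_add (thresholdGraph x t) K
        have h2 := card_large_components_mul_le (thresholdGraph x t) K
        rw [Fintype.card_fin] at h2
        set s := ((smallVertexSets n K).filter fun C =>
          IsComponentSet (thresholdGraph x t) C).card
        set l := (Finset.univ.filter fun C : Finset (Fin n) =>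
          IsComponentSet (thresholdGraph x t) C ∧ K < C.card).card
        have h3 : (l : ℝ) ≤ (n : ℝ) / K := by
          rw [le_div_iff₀ (by exact_mod_cast hK)]
          exact_mod_cast h2
        calc ((Nat.card (thresholdGraph x t).ConnectedComponent - 1 : ℕ) : ENNReal)
            ≤ ((s + l : ℕ) : ENNReal) := Nat.cast_le.2 (by omega)
          _ = (s : ENNReal) + ENNReal.ofReal (l : ℝ) := by
            rw [Nat.cast_add, ENNReal.ofReal_natCast]
          _ ≤ _ := add_le_add_right (ENNReal.ofReal_le_ofReal h3) _
    _ = _ := by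
        rw [lintegral_add_right _ measurable_const, lintegral_const, measure_univ, mul_one]

lemma lintegral_card_sub_one_le_closed [Fact (∀ e, 0 < α e)] (hα : IsDecomposition α d) {t : ℝ}
    (ht : 0 ≤ t) :
    ∫⁻ x, ((Nat.card (thresholdGraph x t).ConnectedComponent - 1 : ℕ) : ENNReal)
        ∂expProduct α ≤ ∑ C ∈ halfVertexSets n,
        ENNReal.ofReal (Real.exp (-(t * (∑ v ∈ C, d v) * ∑ v ∈ Cᶜ, d v))) := by
  classical
  have h := lintegral_card_filter (α := α) (fun G C => IsClosedSet G C) (halfVertexSets n) t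
  simp only [expProduct_real_isClosedSet hα ht] at h
  rw [← h]
  refine lintegral_mono fun x => Nat.cast_le.2
    ((card_connectedComponent_sub_one_le (thresholdGraph x t)).trans (Finset.card_le_card ?_))
  intro C hC
  simpa [halfVertexSets, and_comm] using hC

lemma lintegral_pow_mul_exp_neg (m : ℕ) {a : ℝ} (ha : 0 < a) :
    ∫⁻ t in Set.Ioi (0 : ℝ), ENNReal.ofReal (t ^ m * Real.exp (-(t * a))) =
      ENNReal.ofReal ((m ! : ℝ) / a ^ (m + 1)) := by
  have h := Real.integral_rpow_mul_exp_neg_mul_Ioi (a := (m : ℝ) + 1) (by positivity) ha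
  have h1 : ((1 / a) ^ ((m : ℝ) + 1) * Real.Gamma ((m : ℝ) + 1) : ℝ) =
      (m ! : ℝ) / a ^ (m + 1) := by
    rw [Real.Gamma_nat_eq_factorial, ← Nat.cast_add_one, Real.rpow_natCast, one_div, inv_pow]
    ring
  rw [h1, add_sub_cancel_right] at h
  have h2 : ∀ t : ℝ, t ^ (m : ℝ) * Real.exp (-(a * t)) = t ^ m * Real.exp (-(t * a)) := by
    intro t
    rw [Real.rpow_natCast, mul_comm a t]
  simp_rw [h2] at h
  have hpos : (0 : ℝ) < (m ! : ℝ) / a ^ (m + 1) := by positivity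
  have hint : IntegrableOn (fun t : ℝ => t ^ m * Real.exp (-(t * a))) (Set.Ioi 0) := by
    by_contra hno
    rw [integral_undef hno] at h
    exact hpos.ne h
  rw [← h, ofReal_integral_eq_lintegral_ofReal hint]
  refine (ae_restrict_iff' measurableSet_Ioi).2 (Eventually.of_forall fun t ht => ?_)
  have : (0 : ℝ) < t := ht
  positivity

/-- The tail of the Gamma integral: half of the exponent is given up on `t > c`. -/
lemma lintegral_pow_mul_exp_neg_Ioi_le (m : ℕ) {a c : ℝ} (ha : 0 < a) (hc : 0 ≤ c) :
    ∫⁻ t in Set.Ioi c, ENNReal.ofReal (t ^ m * Real.exp (-(t * a))) ≤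
      ENNReal.ofReal (2 ^ (m + 1) * Real.exp (-(c * a / 2)) * ((m ! : ℝ) / a ^ (m + 1))) := by
  have h := lintegral_pow_mul_exp_neg m (half_pos ha)
  calc _ ≤ ∫⁻ t in Set.Ioi c, ENNReal.ofReal (Real.exp (-(c * a / 2))) *
        ENNReal.ofReal (t ^ m * Real.exp (-(t * (a / 2)))) := by
        refine setLIntegral_mono' measurableSet_Ioi fun t ht => ?_
        have ht' : c < t := ht
        rw [← ENNReal.ofReal_mul (Real.exp_pos _).le]
        refine ENNReal.ofReal_le_ofReal ?_
        rw [mul_left_comm, ← Real.exp_add]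
        refine mul_le_mul_of_nonneg_left (Real.exp_le_exp.2 ?_)
          (pow_nonneg (hc.trans ht'.le) _)
        nlinarith
    _ ≤ ENNReal.ofReal (Real.exp (-(c * a / 2))) * ∫⁻ t in Set.Ioi (0 : ℝ),
        ENNReal.ofReal (t ^ m * Real.exp (-(t * (a / 2)))) := by
        rw [lintegral_const_mul _ (by fun_prop)]
        exact mul_le_mul_right (lintegral_mono_set (Set.Ioi_subset_Ioi hc)) _
    _ = _ := by
        rw [h, ← ENNReal.ofReal_mul (Real.exp_pos _).le]
        congr 1
        rw [div_pow]
        field_simp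

/-- The contribution of the nonempty vertex set `C` to the series. -/
noncomputable def seriesTerm (d : Fin n → ℝ) (C : Finset (Fin n)) : ℝ :=
  ((C.card - 1)! : ℝ) / (∑ v, d v) ^ C.card * ((∏ v ∈ C, d v) / (∑ v ∈ C, d v) ^ 2)

lemma seriesTerm_nonneg (hd : ∀ v, 0 < d v) (C : Finset (Fin n)) : 0 ≤ seriesTerm d C := by
  have h1 : 0 ≤ ∑ v, d v := Finset.sum_nonneg fun v _ => (hd v).le
  have h2 : 0 ≤ ∏ v ∈ C, d v := Finset.prod_nonneg fun v _ => (hd v).le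
  unfold seriesTerm
  positivity

lemma treeWeight_nonneg (hd : ∀ v, 0 < d v) (C : Finset (Fin n)) : 0 ≤ treeWeight d C := by
  have h1 : 0 ≤ ∑ v ∈ C, d v := Finset.sum_nonneg fun v _ => (hd v).le
  have h2 : 0 ≤ ∏ v ∈ C, d v := Finset.prod_nonneg fun v _ => (hd v).le
  unfold treeWeight
  positivity

lemma treeWeight_mul_gamma (hd : ∀ v, 0 < d v) {C : Finset (Fin n)} (hC : C.Nonempty) :
    treeWeight d C * (((C.card - 1)! : ℝ) / ((∑ v ∈ C, d v) * ∑ v, d v) ^ (C.card - 1 + 1)) =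
      seriesTerm d C := by
  have h1 : 0 < ∑ v ∈ C, d v := Finset.sum_pos (fun v _ => hd v) hC
  have h2 : 0 < ∑ v, d v := Finset.sum_pos (fun v _ => hd v) (hC.mono (Finset.subset_univ C))
  rw [Nat.sub_add_cancel (Finset.card_pos.2 hC), treeWeight, seriesTerm, mul_pow]
  field_simp

lemma lintegral_component_le [Fact (∀ e, 0 < α e)] (hα : IsDecomposition α d)
    (hd : ∀ v, 0 < d v) {T ε : ℝ} {C : Finset (Fin n)} (hC : C.Nonempty)
    (hε : T * (∑ v ∈ C, d v) ^ 2 ≤ ε) :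
    ∫⁻ t in Set.Ioc 0 T,
        ENNReal.ofReal ((expProduct α).real {x | IsComponentSet (thresholdGraph x t) C}) ≤
      ENNReal.ofReal (Real.exp ε * seriesTerm d C) := by
  have h1 : 0 < ∑ v ∈ C, d v := Finset.sum_pos (fun v _ => hd v) hC
  have h2 : 0 < ∑ v, d v := Finset.sum_pos (fun v _ => hd v) (hC.mono (Finset.subset_univ C))
  have hW := treeWeight_nonneg hd C
  calc _ ≤ ∫⁻ t in Set.Ioc 0 T, ENNReal.ofReal (Real.exp ε * treeWeight d C) *
        ENNReal.ofReal (t ^ (C.card - 1) * Real.exp (-(t * ((∑ v ∈ C, d v) * ∑ v, d v)))) := by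
        refine setLIntegral_mono' measurableSet_Ioc fun t ht => ?_
        rw [← ENNReal.ofReal_mul (mul_nonneg (Real.exp_pos _).le hW)]
        refine ENNReal.ofReal_le_ofReal (((component_bounds hα hd ht.1.le hC).2).trans ?_)
        rw [mul_assoc (Real.exp ε)]
        refine mul_le_mul_of_nonneg_right (Real.exp_le_exp.2 (le_trans ?_ hε))
          (mul_nonneg hW (mul_nonneg (pow_nonneg ht.1.le _) (Real.exp_pos _).le))
        exact mul_le_mul_of_nonneg_right ht.2 (sq_nonneg _)
    _ ≤ ENNReal.ofReal (Real.exp ε * treeWeight d C) * ∫⁻ t in Set.Ioi (0 : ℝ),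
        ENNReal.ofReal (t ^ (C.card - 1) * Real.exp (-(t * ((∑ v ∈ C, d v) * ∑ v, d v)))) := by
        rw [lintegral_const_mul _ (by fun_prop)]
        exact mul_le_mul_right (lintegral_mono_set Set.Ioc_subset_Ioi_self) _
    _ = _ := by
        rw [lintegral_pow_mul_exp_neg _ (mul_pos h1 h2),
          ← ENNReal.ofReal_mul (mul_nonneg (Real.exp_pos _).le hW), mul_assoc,
          treeWeight_mul_gamma hd hC]

lemma le_lintegral_component [Fact (∀ e, 0 < α e)] (hα : IsDecomposition α d)
    (hd : ∀ v, 0 < d v) {T δ : ℝ} (hT : 0 ≤ T) {C : Finset (Fin n)} (hC : C.Nonempty)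
    (hδ : 2 ^ C.card * Real.exp (-(T * ((∑ v ∈ C, d v) * ∑ v, d v) / 2)) ≤ δ) :
    ENNReal.ofReal (seriesTerm d C) ≤ (∫⁻ t in Set.Ioc 0 T,
        ENNReal.ofReal ((expProduct α).real {x | IsComponentSet (thresholdGraph x t) C})) +
      ENNReal.ofReal (δ * seriesTerm d C) := by
  have h1 : 0 < ∑ v ∈ C, d v := Finset.sum_pos (fun v _ => hd v) hC
  have h2 : 0 < ∑ v, d v := Finset.sum_pos (fun v _ => hd v) (hC.mono (Finset.subset_univ C))
  have hW := treeWeight_nonneg hd C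
  have hsplit : Set.Ioi (0 : ℝ) = Set.Ioc 0 T ∪ Set.Ioi T := (Set.Ioc_union_Ioi_eq_Ioi hT).symm
  have ha := mul_pos h1 h2
  calc ENNReal.ofReal (seriesTerm d C)
      = ENNReal.ofReal (treeWeight d C) * ∫⁻ t in Set.Ioi (0 : ℝ),
        ENNReal.ofReal (t ^ (C.card - 1) * Real.exp (-(t * ((∑ v ∈ C, d v) * ∑ v, d v)))) := by
        rw [lintegral_pow_mul_exp_neg _ ha, ← ENNReal.ofReal_mul hW, treeWeight_mul_gamma hd hC]
    _ = (ENNReal.ofReal (treeWeight d C) * ∫⁻ t in Set.Ioc (0 : ℝ) T,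
          ENNReal.ofReal (t ^ (C.card - 1) * Real.exp (-(t * ((∑ v ∈ C, d v) * ∑ v, d v))))) +
        ENNReal.ofReal (treeWeight d C) * ∫⁻ t in Set.Ioi T,
          ENNReal.ofReal (t ^ (C.card - 1) * Real.exp (-(t * ((∑ v ∈ C, d v) * ∑ v, d v)))) := by
        rw [hsplit, lintegral_union measurableSet_Ioi
          (Set.Ioc_disjoint_Ioi le_rfl), mul_add]
    _ ≤ _ := by
        refine add_le_add ?_ ?_
        · rw [← lintegral_const_mul _ (by fun_prop)]
          refine setLIntegral_mono' measurableSet_Ioc fun t ht => ?_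
          rw [← ENNReal.ofReal_mul hW]
          exact ENNReal.ofReal_le_ofReal (component_bounds hα hd ht.1.le hC).1
        · refine (mul_le_mul_right (lintegral_pow_mul_exp_neg_Ioi_le _ ha hT) _).trans ?_
          rw [← ENNReal.ofReal_mul hW]
          refine ENNReal.ofReal_le_ofReal ?_
          rw [mul_left_comm, treeWeight_mul_gamma hd hC,
            Nat.sub_add_cancel (Finset.card_pos.2 hC)]
          exact mul_le_mul_of_nonneg_right hδ (seriesTerm_nonneg hd C)

lemma measurable_component_real [Fact (∀ e, 0 < α e)] (C : Finset (Fin n)) :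
    Measurable fun t => ENNReal.ofReal
      ((expProduct α).real {x | IsComponentSet (thresholdGraph x t) C}) := by
  have h := measurableSet_thresholdGraph (n := n) (fun G => IsComponentSet G C)
  have h1 : (fun t => ENNReal.ofReal
      ((expProduct α).real {x | IsComponentSet (thresholdGraph x t) C})) =
      fun t => expProduct α {x | IsComponentSet (thresholdGraph x t) C} :=
    funext fun t => ofReal_measureReal
  rw [h1]
  exact measurable_measure_prodMk_right h

lemma lintegral_exp_neg_mul_Ioi {b T : ℝ} (hb : 0 < b) :
    ∫⁻ t in Set.Ioi T, ENNReal.ofReal (Real.exp (-(t * b))) =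
      ENNReal.ofReal (Real.exp (-(T * b)) / b) := by
  have h := integral_exp_mul_Ioi (a := -b) (by linarith) T
  have hint := integrableOn_exp_mul_Ioi (a := -b) (by linarith) T
  have h2 : ∀ t : ℝ, Real.exp (-b * t) = Real.exp (-(t * b)) := fun t => by
    congr 1
    ring
  simp_rw [h2] at h hint
  rw [show Real.exp (-(T * b)) / b = -Real.exp (-(T * b)) / -b by rw [neg_div_neg_eq], ← h,
    ofReal_integral_eq_lintegral_ofReal hint (Eventually.of_forall fun _ => (Real.exp_pos _).le)]

/-- Lower bound for the expected minimum spanning tree weight: only the components with at most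
`K` vertices before time `T` are counted. The number `δ` bounds the part of each Gamma integral
beyond `T`, and `T` itself accounts for the `-1` in `κ(t) - 1`. -/
lemma sum_seriesTerm_le [Fact (∀ e, 0 < α e)] (hn : 0 < n) (hα : IsDecomposition α d)
    (hd : ∀ v, 0 < d v) {T δ : ℝ} (hT : 0 ≤ T) (K : ℕ)
    (hδ : ∀ C : Finset (Fin n), C.Nonempty →
      2 ^ C.card * Real.exp (-(T * ((∑ v ∈ C, d v) * ∑ v, d v) / 2)) ≤ δ) :
    ENNReal.ofReal (∑ C ∈ smallVertexSets n K, seriesTerm d C) ≤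
      ∫⁻ x, ENNReal.ofReal (mstWeight x) ∂expProduct α + ENNReal.ofReal T +
        ENNReal.ofReal (δ * ∑ C ∈ smallVertexSets n K, seriesTerm d C) := by
  have hδ0 : ∀ C ∈ smallVertexSets n K, 0 ≤ δ * seriesTerm d C := by
    intro C hC
    have hC' := (Finset.mem_filter.1 hC).2.1
    exact mul_nonneg ((by positivity : (0 : ℝ) ≤ _).trans (hδ C hC')) (seriesTerm_nonneg hd C)
  rw [Finset.mul_sum, ENNReal.ofReal_sum_of_nonneg fun C _ => seriesTerm_nonneg hd C,
    ENNReal.ofReal_sum_of_nonneg hδ0]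
  refine (Finset.sum_le_sum fun C hC => le_lintegral_component hα hd hT
    (Finset.mem_filter.1 hC).2.1 (hδ C (Finset.mem_filter.1 hC).2.1)).trans ?_
  rw [Finset.sum_add_distrib]
  refine add_le_add_left ?_ _
  rw [← lintegral_finsetSum _ fun C _ => measurable_component_real C, lintegral_mstWeight_eq hn]
  calc _ ≤ ∫⁻ t in Set.Ioc 0 T, (∫⁻ x, ((Nat.card (thresholdGraph x t).ConnectedComponent - 1 : ℕ)
        : ENNReal) ∂expProduct α + 1) := lintegral_mono fun t => sum_component_le hn K t
    _ = (∫⁻ t in Set.Ioc 0 T, ∫⁻ x, ((Nat.card (thresholdGraph x t).ConnectedComponent - 1 : ℕ)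
        : ENNReal) ∂expProduct α) + ENNReal.ofReal T := by
        rw [lintegral_add_right _ measurable_const, lintegral_one, Measure.restrict_apply_univ,
          Real.volume_Ioc, sub_zero]
    _ ≤ _ := add_le_add_left (lintegral_mono_set Set.Ioc_subset_Ioi_self) _

/-- Upper bound for the expected minimum spanning tree weight: up to time `T` there are the
components with at most `K` vertices and at most `n / K` larger ones; after time `T` the union
bound over the sets of at most half of the vertices is used. -/
lemma lintegral_mstWeight_le [Fact (∀ e, 0 < α e)] (hn : 0 < n) (hα : IsDecomposition α d)
    (hd : ∀ v, 0 < d v) {T ε : ℝ} (hT : 0 ≤ T) {K : ℕ} (hK : 0 < K)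
    (hε : ∀ C ∈ smallVertexSets n K, T * (∑ v ∈ C, d v) ^ 2 ≤ ε) :
    ∫⁻ x, ENNReal.ofReal (mstWeight x) ∂expProduct α ≤
      ENNReal.ofReal (Real.exp ε * (∑ C ∈ smallVertexSets n K, seriesTerm d C) + T * (n / K) +
        ∑ C ∈ halfVertexSets n, Real.exp (-(T * ((∑ v ∈ C, d v) * ∑ v ∈ Cᶜ, d v))) /
          ((∑ v ∈ C, d v) * ∑ v ∈ Cᶜ, d v)) := by
  have hS : 0 ≤ ∑ C ∈ smallVertexSets n K, seriesTerm d C :=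
    Finset.sum_nonneg fun C _ => seriesTerm_nonneg hd C
  have hhalf : ∀ C ∈ halfVertexSets n, 0 < (∑ v ∈ C, d v) * ∑ v ∈ Cᶜ, d v := by
    intro C hC
    have hC' := (Finset.mem_filter.1 hC).2
    refine mul_pos (Finset.sum_pos (fun v _ => hd v) hC'.1)
      (Finset.sum_pos (fun v _ => hd v) ?_)
    rw [← Finset.card_pos, Finset.card_compl, Fintype.card_fin]
    have := Finset.card_pos.2 hC'.1
    omega
  have hsplit : Set.Ioi (0 : ℝ) = Set.Ioc 0 T ∪ Set.Ioi T := (Set.Ioc_union_Ioi_eq_Ioi hT).symm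
  rw [lintegral_mstWeight_eq hn, hsplit, lintegral_union measurableSet_Ioi
    (Set.Ioc_disjoint_Ioi le_rfl), ENNReal.ofReal_add (by positivity)
      (Finset.sum_nonneg fun C hC => div_nonneg (Real.exp_pos _).le (hhalf C hC).le),
    ENNReal.ofReal_add (by positivity) (by positivity)]
  refine add_le_add ?_ ?_
  · calc _ ≤ ∫⁻ t in Set.Ioc 0 T, (∑ C ∈ smallVertexSets n K,
        ENNReal.ofReal ((expProduct α).real {x | IsComponentSet (thresholdGraph x t) C}) +
          ENNReal.ofReal ((n : ℝ) / K)) :=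
        lintegral_mono fun t => lintegral_card_sub_one_le hK t
      _ = ∑ C ∈ smallVertexSets n K, (∫⁻ t in Set.Ioc 0 T,
        ENNReal.ofReal ((expProduct α).real {x | IsComponentSet (thresholdGraph x t) C})) +
          ENNReal.ofReal (T * (n / K)) := by
        rw [lintegral_add_right _ measurable_const, lintegral_const, Measure.restrict_apply_univ,
          Real.volume_Ioc, sub_zero, lintegral_finsetSum _ fun C _ => measurable_component_real C,
          mul_comm (ENNReal.ofReal _), ENNReal.ofReal_mul hT]
      _ ≤ _ := by
        refine add_le_add_left ?_ _
        rw [Finset.mul_sum, ENNReal.ofReal_sum_of_nonneg fun C _ =>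
          mul_nonneg (Real.exp_pos _).le (seriesTerm_nonneg hd C)]
        exact Finset.sum_le_sum fun C hC => lintegral_component_le hα hd
          (Finset.mem_filter.1 hC).2.1 (hε C hC)
  · refine (setLIntegral_mono' measurableSet_Ioi fun t ht =>
      lintegral_card_sub_one_le_closed hα (hT.trans (le_of_lt ht))).trans ?_
    rw [lintegral_finsetSum _ fun C _ => by fun_prop, ENNReal.ofReal_sum_of_nonneg
      fun C hC => div_nonneg (Real.exp_pos _).le (hhalf C hC).le]
    refine le_of_eq (Finset.sum_congr rfl fun C hC => ?_)
    rw [← lintegral_exp_neg_mul_Ioi (hhalf C hC)]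
    simp only [mul_assoc]

end TimeIntegral

/-! ### The series -/

section Series

variable {n : ℕ} {d : Fin n → ℝ}

lemma pow_succ_add_le_add_pow {x a : ℝ} (hx : 0 ≤ x) (ha : 0 ≤ a) (m : ℕ) :
    x ^ (m + 1) + (m + 1) * a * x ^ m ≤ (a + x) ^ (m + 1) := by
  induction m with
  | zero => simp [add_comm]
  | succ m ih =>
    have h := mul_le_mul_of_nonneg_left ih (add_nonneg ha hx)
    have h2 : 0 ≤ ((m : ℝ) + 1) * a ^ 2 * x ^ m := by positivity
    rw [pow_succ' (a + x) (m + 1)]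
    push_cast
    refine le_trans ?_ h
    have h3 : x ^ (m + 1 + 1) = x * x ^ (m + 1) := by ring
    have h4 : x ^ (m + 1) = x * x ^ m := by ring
    rw [h3, h4]
    nlinarith

/-- The elementary symmetric polynomials of nonnegative numbers are bounded by the terms of the
exponential series of their sum. -/
lemma factorial_mul_sum_powersetCard_le {V : Type*} [DecidableEq V] {d : V → ℝ}
    (hd : ∀ v, 0 ≤ d v) (S : Finset V) (m : ℕ) :
    (m ! : ℝ) * ∑ C ∈ S.powersetCard m, ∏ v ∈ C, d v ≤ (∑ v ∈ S, d v) ^ m := by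
  induction S using Finset.induction_on generalizing m with
  | empty =>
    cases m with
    | zero => simp
    | succ m => rw [Finset.powersetCard_eq_empty.2 (by simp)]; simp
  | insert a S ha ih =>
    cases m with
    | zero => simp
    | succ m =>
      have hdis : Disjoint (S.powersetCard (m + 1)) ((S.powersetCard m).image (insert a)) := by
        rw [Finset.disjoint_left]
        intro C hC hC'
        obtain ⟨C', -, rfl⟩ := Finset.mem_image.1 hC'
        exact ha ((Finset.mem_powersetCard.1 hC).1 (Finset.mem_insert_self _ _))
      have hinj : Set.InjOn (insert a) (S.powersetCard m : Set (Finset V)) := by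
        intro C hC C' hC' h
        have h1 : a ∉ C := fun h => ha ((Finset.mem_powersetCard.1 hC).1 h)
        have h2 : a ∉ C' := fun h => ha ((Finset.mem_powersetCard.1 hC').1 h)
        rw [← Finset.erase_insert h1, ← Finset.erase_insert h2, h]
      have hins : ∀ C ∈ S.powersetCard m, ∏ v ∈ insert a C, d v = d a * ∏ v ∈ C, d v := by
        intro C hC
        exact Finset.prod_insert fun h => ha ((Finset.mem_powersetCard.1 hC).1 h)
      rw [Finset.powersetCard_succ_insert ha, Finset.sum_union hdis, Finset.sum_image hinj,
        Finset.sum_congr rfl hins, ← Finset.mul_sum, Finset.sum_insert ha]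
      refine le_trans ?_ (pow_succ_add_le_add_pow (Finset.sum_nonneg fun v _ => hd v) (hd a) m)
      have h1 := ih (m + 1)
      have h2 := mul_le_mul_of_nonneg_left (ih m) (mul_nonneg (Nat.cast_add_one_pos m).le (hd a))
      have h3 : ((m + 1)! : ℝ) = (m + 1) * m ! := by
        rw [Nat.factorial_succ]
        push_cast
        ring
      rw [mul_add]
      refine add_le_add h1 (le_trans (le_of_eq ?_) h2)
      rw [h3]
      ring

/-- The contribution of the vertex sets of size `k + 1` to the series. -/
noncomputable def seriesLayer (d : Fin n → ℝ) (k : ℕ) : ℝ :=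
  ∑ C ∈ Finset.powersetCard (k + 1) (Finset.univ : Finset (Fin n)), seriesTerm d C

lemma mstSeries_eq_tsum (d : Fin n → ℝ) : mstSeries d = ∑' k, seriesLayer d k := by
  unfold mstSeries seriesLayer
  refine tsum_congr fun k => ?_
  rw [Finset.mul_sum]
  refine Finset.sum_congr rfl fun C hC => ?_
  rw [seriesTerm, (Finset.mem_powersetCard.1 hC).2, Nat.add_sub_cancel]

lemma sum_smallVertexSets_eq (K : ℕ) (f : Finset (Fin n) → ℝ) :
    ∑ C ∈ smallVertexSets n K, f C = ∑ k ∈ Finset.range K,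
      ∑ C ∈ Finset.powersetCard (k + 1) (Finset.univ : Finset (Fin n)), f C := by
  rw [← Finset.sum_fiberwise_of_maps_to (s := smallVertexSets n K) (t := Finset.range K)
    (g := fun C => C.card - 1)]
  · refine Finset.sum_congr rfl fun k hk => Finset.sum_congr ?_ fun _ _ => rfl
    ext C
    rw [Finset.mem_range] at hk
    simp only [smallVertexSets, Finset.mem_filter, Finset.mem_univ, true_and,
      Finset.mem_powersetCard, Finset.subset_univ, ← Finset.card_pos]
    omega
  · intro C hC
    simp only [smallVertexSets, Finset.mem_filter, Finset.mem_univ, true_and,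
      ← Finset.card_pos] at hC
    rw [Finset.mem_range]
    omega

lemma seriesLayer_nonneg (hd : ∀ v, 0 < d v) (k : ℕ) : 0 ≤ seriesLayer d k :=
  Finset.sum_nonneg fun C _ => seriesTerm_nonneg hd C

lemma seriesLayer_le (hn : 0 < n) {ω : ℝ} (hω : 0 < ω) (hd : ∀ v, ω⁻¹ ≤ d v) (k : ℕ) :
    seriesLayer d k ≤ ω ^ 2 / ((k : ℝ) + 1) ^ 3 := by
  have hd0 : ∀ v, 0 < d v := fun v => (inv_pos.2 hω).trans_le (hd v)
  have hD : 0 < ∑ v, d v := Finset.sum_pos (fun v _ => hd0 v) ⟨⟨0, hn⟩, Finset.mem_univ _⟩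
  have hC : ∀ C ∈ Finset.powersetCard (k + 1) (Finset.univ : Finset (Fin n)), seriesTerm d C ≤
      (k ! : ℝ) / (∑ v, d v) ^ (k + 1) * (ω ^ 2 / ((k : ℝ) + 1) ^ 2) * ∏ v ∈ C, d v := by
    intro C hC
    have hcard := (Finset.mem_powersetCard.1 hC).2
    have hp : 0 ≤ ∏ v ∈ C, d v := Finset.prod_nonneg fun v _ => (hd0 v).le
    have h1 : ((k : ℝ) + 1) * ω⁻¹ ≤ ∑ v ∈ C, d v := by
      have := Finset.card_nsmul_le_sum C d ω⁻¹ fun v _ => hd v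
      rw [hcard, nsmul_eq_mul] at this
      exact_mod_cast this
    have h2 : 0 < ((k : ℝ) + 1) * ω⁻¹ := by positivity
    rw [seriesTerm, hcard, Nat.add_sub_cancel, mul_assoc]
    refine mul_le_mul_of_nonneg_left ?_ (by positivity)
    rw [mul_comm (ω ^ 2 / _), div_eq_mul_inv]
    refine mul_le_mul_of_nonneg_left ?_ hp
    calc ((∑ v ∈ C, d v) ^ 2)⁻¹ ≤ ((((k : ℝ) + 1) * ω⁻¹) ^ 2)⁻¹ :=
          inv_anti₀ (by positivity) (pow_le_pow_left₀ h2.le h1 2)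
      _ = ω ^ 2 / ((k : ℝ) + 1) ^ 2 := by field_simp
  have h3 := factorial_mul_sum_powersetCard_le (fun v => (hd0 v).le)
    (Finset.univ : Finset (Fin n)) (k + 1)
  have h4 : ((k + 1)! : ℝ) = (k + 1) * k ! := by
    rw [Nat.factorial_succ]
    push_cast
    ring
  calc seriesLayer d k ≤ ∑ C ∈ Finset.powersetCard (k + 1) (Finset.univ : Finset (Fin n)),
        (k ! : ℝ) / (∑ v, d v) ^ (k + 1) * (ω ^ 2 / ((k : ℝ) + 1) ^ 2) * ∏ v ∈ C, d v :=
        Finset.sum_le_sum hC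
    _ = ω ^ 2 / (((k : ℝ) + 1) ^ 3 * (∑ v, d v) ^ (k + 1)) * (((k + 1)! : ℝ) *
        ∑ C ∈ Finset.powersetCard (k + 1) (Finset.univ : Finset (Fin n)), ∏ v ∈ C, d v) := by
        rw [← Finset.mul_sum, h4]
        field_simp
    _ ≤ ω ^ 2 / (((k : ℝ) + 1) ^ 3 * (∑ v, d v) ^ (k + 1)) * (∑ v, d v) ^ (k + 1) :=
        mul_le_mul_of_nonneg_left h3 (by positivity)
    _ = _ := by field_simp

lemma summable_one_div_add_one_sq : Summable fun k : ℕ => 1 / ((k : ℝ) + 1) ^ 2 := by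
  have := (summable_nat_add_iff 1).2 (Real.summable_one_div_nat_pow.2 (one_lt_two))
  simpa using this

lemma summable_one_div_add_one_cube : Summable fun k : ℕ => 1 / ((k : ℝ) + 1) ^ 3 := by
  have := (summable_nat_add_iff 1).2 (Real.summable_one_div_nat_pow.2 (by norm_num : 1 < 3))
  simpa using this

lemma summable_seriesLayer (hn : 0 < n) {ω : ℝ} (hω : 0 < ω) (hd : ∀ v, ω⁻¹ ≤ d v) :
    Summable (seriesLayer d) := by
  refine Summable.of_nonneg_of_le
    (seriesLayer_nonneg fun v => (inv_pos.2 hω).trans_le (hd v)) (seriesLayer_le hn hω hd) ?_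
  simpa [div_eq_mul_inv] using summable_one_div_add_one_cube.mul_left (ω ^ 2)

lemma sum_range_le_mstSeries (hn : 0 < n) {ω : ℝ} (hω : 0 < ω) (hd : ∀ v, ω⁻¹ ≤ d v) (K : ℕ) :
    ∑ C ∈ smallVertexSets n K, seriesTerm d C ≤ mstSeries d := by
  rw [sum_smallVertexSets_eq, mstSeries_eq_tsum]
  exact (summable_seriesLayer hn hω hd).sum_le_tsum _ fun k _ =>
    seriesLayer_nonneg (fun v => (inv_pos.2 hω).trans_le (hd v)) k

/-- The large vertex sets contribute little to the series. -/
lemma mstSeries_le_add (hn : 0 < n) {ω : ℝ} (hω : 0 < ω) (hd : ∀ v, ω⁻¹ ≤ d v) {K : ℕ}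
    (hK : 0 < K) :
    mstSeries d ≤ ∑ C ∈ smallVertexSets n K, seriesTerm d C +
      ω ^ 2 * (∑' k : ℕ, 1 / ((k : ℝ) + 1) ^ 2) / K := by
  have hs := summable_seriesLayer hn hω hd
  rw [sum_smallVertexSets_eq, mstSeries_eq_tsum, ← hs.sum_add_tsum_nat_add K]
  refine add_le_add_right ?_ _
  rw [mul_div_right_comm, ← tsum_mul_left]
  refine Summable.tsum_le_tsum (fun k => (seriesLayer_le hn hω hd _).trans ?_)
    ((summable_nat_add_iff K).2 hs) (summable_one_div_add_one_sq.mul_left _)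
  have hK' : (0 : ℝ) < K := by exact_mod_cast hK
  rw [div_mul_div_comm, mul_one]
  refine div_le_div_of_nonneg_left (sq_nonneg ω) (by positivity) ?_
  push_cast
  have h1 : (K : ℝ) ≤ (k : ℝ) + K + 1 := by
    have : (0 : ℝ) ≤ k := k.cast_nonneg
    linarith
  have h2 : ((k : ℝ) + 1) ^ 2 ≤ ((k : ℝ) + K + 1) ^ 2 :=
    pow_le_pow_left₀ (by positivity) (by linarith) 2
  calc (K : ℝ) * ((k : ℝ) + 1) ^ 2 ≤ ((k : ℝ) + K + 1) * ((k : ℝ) + K + 1) ^ 2 :=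
        mul_le_mul h1 h2 (by positivity) (by positivity)
    _ = _ := by ring

lemma inv_sq_le_mstSeries (hn : 0 < n) {ω : ℝ} (hω : 0 < ω)
    (hd : ∀ v, d v ∈ Set.Icc ω⁻¹ ω) : (ω ^ 2)⁻¹ ≤ mstSeries d := by
  have hd0 : ∀ v, 0 < d v := fun v => (inv_pos.2 hω).trans_le (hd v).1
  have hn' : (0 : ℝ) < n := by exact_mod_cast hn
  have hD : 0 < ∑ v, d v := Finset.sum_pos (fun v _ => hd0 v) ⟨⟨0, hn⟩, Finset.mem_univ _⟩
  have hDle : ∑ v, d v ≤ n * ω := by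
    have := Finset.sum_le_card_nsmul Finset.univ d ω fun v _ => (hd v).2
    simpa using this
  have h := (summable_seriesLayer hn hω fun v => (hd v).1).le_tsum 0 fun k _ =>
    seriesLayer_nonneg hd0 k
  rw [← mstSeries_eq_tsum] at h
  refine le_trans ?_ h
  have h1 : seriesLayer d 0 = (∑ v, d v)⁻¹ * ∑ v, (d v)⁻¹ := by
    rw [seriesLayer, zero_add, Finset.powersetCard_one, Finset.sum_map, Finset.mul_sum]
    refine Finset.sum_congr rfl fun v _ => ?_
    have := (hd0 v).ne'
    simp only [seriesTerm, Function.Embedding.coeFn_mk, Finset.card_singleton, Nat.sub_self,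
      Nat.factorial_zero, Nat.cast_one, pow_one, Finset.prod_singleton, Finset.sum_singleton]
    field_simp
  have h2 : n * ω⁻¹ ≤ ∑ v, (d v)⁻¹ := by
    have := Finset.card_nsmul_le_sum Finset.univ (fun v => (d v)⁻¹) ω⁻¹
      fun v _ => inv_anti₀ (hd0 v) (hd v).2
    simpa using this
  rw [h1]
  calc (ω ^ 2)⁻¹ = (n * ω)⁻¹ * (n * ω⁻¹) := by field_simp
    _ ≤ _ := mul_le_mul (inv_anti₀ hD hDle) h2 (by positivity) (by positivity)

end Series

/-! ### Bounds for a fixed number of vertices -/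

section FixedSize

variable {n : ℕ} {α : KEdge n → ℝ} {d : Fin n → ℝ}

lemma card_mul_inv_le_sum {ω : ℝ} (hd : ∀ v, ω⁻¹ ≤ d v) (C : Finset (Fin n)) :
    C.card * ω⁻¹ ≤ ∑ v ∈ C, d v := by
  have := Finset.card_nsmul_le_sum C d ω⁻¹ fun v _ => hd v
  rwa [nsmul_eq_mul] at this

/-- After the time `4 ω² log n / n` the threshold graph is connected with such a probability that
the remaining contribution to the expected weight is negligible. -/
lemma sum_halfVertexSets_le (hn : 2 ≤ n) {ω : ℝ} (hω : 1 ≤ ω) (hd : ∀ v, ω⁻¹ ≤ d v) :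
    ∑ C ∈ halfVertexSets n, Real.exp (-(4 * ω ^ 2 * Real.log n / n *
        ((∑ v ∈ C, d v) * ∑ v ∈ Cᶜ, d v))) / ((∑ v ∈ C, d v) * ∑ v ∈ Cᶜ, d v) ≤
      4 * ω ^ 2 / (n : ℝ) ^ 2 := by
  have hω0 : 0 < ω := by linarith
  have hn0 : (0 : ℝ) < n := by
    have : 0 < n := by omega
    exact_mod_cast this
  have hlog : 0 ≤ Real.log n := Real.log_natCast_nonneg n
  set q : ℝ := ((n : ℝ) ^ 2)⁻¹ with hq
  have hterm : ∀ C ∈ halfVertexSets n, Real.exp (-(4 * ω ^ 2 * Real.log n / n *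
        ((∑ v ∈ C, d v) * ∑ v ∈ Cᶜ, d v))) / ((∑ v ∈ C, d v) * ∑ v ∈ Cᶜ, d v) ≤
      2 * ω ^ 2 / n * q ^ C.card := by
    intro C hC
    have hC' := (Finset.mem_filter.1 hC).2
    have hk : (1 : ℝ) ≤ C.card := by exact_mod_cast Finset.card_pos.2 hC'.1
    have hcc : (n : ℝ) / 2 ≤ Cᶜ.card := by
      have h1 : C.card + Cᶜ.card = n := by
        rw [Finset.card_add_card_compl, Fintype.card_fin]
      have h2 : n ≤ 2 * Cᶜ.card := by omega
      have h3 : (n : ℝ) ≤ 2 * (Cᶜ.card : ℝ) := by exact_mod_cast h2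
      linarith
    have hb : (C.card : ℝ) * (n / (2 * ω ^ 2)) ≤ (∑ v ∈ C, d v) * ∑ v ∈ Cᶜ, d v := by
      calc (C.card : ℝ) * (n / (2 * ω ^ 2)) = (C.card * ω⁻¹) * (n / 2 * ω⁻¹) := by field_simp
        _ ≤ (∑ v ∈ C, d v) * ∑ v ∈ Cᶜ, d v := by
          refine mul_le_mul (card_mul_inv_le_sum hd C) (le_trans ?_ (card_mul_inv_le_sum hd Cᶜ))
            (by positivity) ((by positivity : (0 : ℝ) ≤ _).trans (card_mul_inv_le_sum hd C))
          exact mul_le_mul_of_nonneg_right hcc (by positivity)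
    have hb2 : n / (2 * ω ^ 2) ≤ (∑ v ∈ C, d v) * ∑ v ∈ Cᶜ, d v := by
      refine le_trans ?_ hb
      exact le_mul_of_one_le_left (by positivity) hk
    have hb0 : 0 < n / (2 * ω ^ 2) := by positivity
    -- the time is chosen such that `e^{-t n / (2 ω²)} = n⁻²`
    have hexp : Real.exp (-(4 * ω ^ 2 * Real.log n / n *
        ((∑ v ∈ C, d v) * ∑ v ∈ Cᶜ, d v))) ≤ q ^ C.card := by
      have h1 : q ^ C.card = Real.exp (-(4 * ω ^ 2 * Real.log n / n *
          ((C.card : ℝ) * (n / (2 * ω ^ 2))))) := by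
        rw [hq, ← Real.exp_log hn0, ← Real.exp_nat_mul, ← Real.exp_neg, ← Real.exp_nat_mul,
          Real.exp_log hn0]
        congr 1
        push_cast
        field_simp
        ring
      rw [h1]
      refine Real.exp_le_exp.2 (neg_le_neg (mul_le_mul_of_nonneg_left hb (by positivity)))
    calc _ ≤ q ^ C.card / (n / (2 * ω ^ 2)) :=
          div_le_div₀ (by positivity) hexp hb0 hb2
      _ = _ := by field_simp
  -- the binomial theorem; the empty set accounts for the `1` in `e^{1/n} - 1 ≤ 2/n`
  have hsum : ∑ C ∈ halfVertexSets n, q ^ C.card ≤ 2 / n := by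
    have h1 : ∑ C ∈ insert ∅ (halfVertexSets n), q ^ C.card ≤ (q + 1) ^ n := by
      have h := Finset.sum_pow_mul_eq_add_pow q 1 (Finset.univ : Finset (Fin n))
      simp only [one_pow, mul_one, Finset.powerset_univ, Finset.card_univ, Fintype.card_fin] at h
      rw [← h]
      exact Finset.sum_le_sum_of_subset_of_nonneg (Finset.subset_univ _) fun C _ _ => by positivity
    rw [Finset.sum_insert (by simp [halfVertexSets])] at h1
    have h2 : (q + 1) ^ n ≤ Real.exp (1 / n) := by
      calc (q + 1) ^ n ≤ Real.exp q ^ n :=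
            pow_le_pow_left₀ (by positivity) (Real.add_one_le_exp q) n
        _ = Real.exp (1 / n) := by
            rw [← Real.exp_nat_mul, hq]
            congr 1
            field_simp
    have h3 : |Real.exp (1 / n) - 1| ≤ 2 * |1 / (n : ℝ)| := by
      refine Real.abs_exp_sub_one_le ?_
      rw [abs_of_pos (by positivity), div_le_one hn0]
      exact_mod_cast (by omega : 1 ≤ n)
    rw [abs_of_pos (by positivity : (0 : ℝ) < 1 / n), mul_one_div] at h3
    have h4 := (le_abs_self _).trans h3
    simp only [Finset.card_empty, pow_zero] at h1
    linarith
  calc _ ≤ ∑ C ∈ halfVertexSets n, 2 * ω ^ 2 / n * q ^ C.card := Finset.sum_le_sum hterm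
    _ = 2 * ω ^ 2 / n * ∑ C ∈ halfVertexSets n, q ^ C.card := by rw [Finset.mul_sum]
    _ ≤ 2 * ω ^ 2 / n * (2 / n) := mul_le_mul_of_nonneg_left hsum (by positivity)
    _ = _ := by
      field_simp
      ring

/-- Both bounds at the cut-off time `4 ω² log n / n`, with the sizes of all error terms. -/
lemma expected_exp_bounds (hn : 2 ≤ n) (hα : IsDecomposition α d) {ω : ℝ} (hω : 1 ≤ ω)
    (hd : ∀ v, d v ∈ Set.Icc ω⁻¹ ω) {K : ℕ} (hK : 0 < K) :
    (∫⁻ x, ENNReal.ofReal (mstWeight x) ∂expProduct α).toReal ≤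
      Real.exp (4 * ω ^ 2 * Real.log n / n * (K * ω) ^ 2) *
        (∑ C ∈ smallVertexSets n K, seriesTerm d C) +
        4 * ω ^ 2 * Real.log n / n * (n / K) + 4 * ω ^ 2 / (n : ℝ) ^ 2 ∧
    (1 - 2 / (n : ℝ) ^ 2) * (∑ C ∈ smallVertexSets n K, seriesTerm d C) ≤
      (∫⁻ x, ENNReal.ofReal (mstWeight x) ∂expProduct α).toReal +
        4 * ω ^ 2 * Real.log n / n := by
  have hω0 : 0 < ω := by linarith
  have hd0 : ∀ v, 0 < d v := fun v => (inv_pos.2 hω0).trans_le (hd v).1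
  have := Fact.mk (hα.pos hd0)
  have hnpos : 0 < n := by omega
  have hn0 : (0 : ℝ) < n := by exact_mod_cast hnpos
  have hn2 : (2 : ℝ) ≤ n := by exact_mod_cast hn
  have hlog : 0 ≤ Real.log n := Real.log_natCast_nonneg n
  set T := 4 * ω ^ 2 * Real.log n / n with hT
  have hT0 : 0 ≤ T := by positivity
  have hS : 0 ≤ ∑ C ∈ smallVertexSets n K, seriesTerm d C :=
    Finset.sum_nonneg fun C _ => seriesTerm_nonneg hd0 C
  have hup := lintegral_mstWeight_le hnpos hα hd0 (T := T) (ε := T * (K * ω) ^ 2) hT0 hK (by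
    intro C hC
    have hcard := (Finset.mem_filter.1 hC).2.2
    refine mul_le_mul_of_nonneg_left (pow_le_pow_left₀
      (Finset.sum_nonneg fun v _ => (hd0 v).le) ?_ 2) hT0
    have := Finset.sum_le_card_nsmul C d ω fun v _ => (hd v).2
    rw [nsmul_eq_mul] at this
    refine this.trans (mul_le_mul_of_nonneg_right ?_ hω0.le)
    exact_mod_cast hcard)
  have hfin : ∫⁻ x, ENNReal.ofReal (mstWeight x) ∂expProduct α ≠ ⊤ :=
    (hup.trans_lt ENNReal.ofReal_lt_top).ne
  have htail := sum_halfVertexSets_le hn hω fun v => (hd v).1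
  rw [← hT] at htail
  constructor
  · refine (ENNReal.toReal_le_of_le_ofReal ?_ (hup.trans
      (ENNReal.ofReal_le_ofReal (add_le_add_right htail _))))
    positivity
  · have hlo := sum_seriesTerm_le hnpos hα hd0 (T := T) (δ := 2 / (n : ℝ) ^ 2) hT0 K (by
      intro C hC
      have hk : C.card ≠ 0 := (Finset.card_pos.2 hC).ne'
      have hb : (C.card : ℝ) * n / ω ^ 2 ≤ (∑ v ∈ C, d v) * ∑ v, d v := by
        have h1 := card_mul_inv_le_sum (fun v => (hd v).1) C
        have h2 := card_mul_inv_le_sum (fun v => (hd v).1) (Finset.univ : Finset (Fin n))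
        rw [Finset.card_univ, Fintype.card_fin] at h2
        calc (C.card : ℝ) * n / ω ^ 2 = (C.card * ω⁻¹) * (n * ω⁻¹) := by field_simp
          _ ≤ _ := mul_le_mul h1 h2 (by positivity) ((by positivity : (0 : ℝ) ≤ _).trans h1)
      have h1 : Real.exp (-(T * ((∑ v ∈ C, d v) * ∑ v, d v) / 2)) ≤
          (((n : ℝ) ^ 2)⁻¹) ^ C.card := by
        have h2 : (((n : ℝ) ^ 2)⁻¹) ^ C.card =
            Real.exp (-(T * ((C.card : ℝ) * n / ω ^ 2) / 2)) := by
          rw [← Real.exp_log hn0, ← Real.exp_nat_mul, ← Real.exp_neg, ← Real.exp_nat_mul,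
            Real.exp_log hn0, hT]
          congr 1
          push_cast
          field_simp
          ring
        rw [h2]
        refine Real.exp_le_exp.2 (neg_le_neg ?_)
        have := mul_le_mul_of_nonneg_left hb hT0
        linarith
      have h3 : 2 / (n : ℝ) ^ 2 ≤ 1 := by
        rw [div_le_one (by positivity)]
        nlinarith
      calc 2 ^ C.card * Real.exp (-(T * ((∑ v ∈ C, d v) * ∑ v, d v) / 2))
          ≤ 2 ^ C.card * (((n : ℝ) ^ 2)⁻¹) ^ C.card :=
            mul_le_mul_of_nonneg_left h1 (by positivity)
        _ = (2 / (n : ℝ) ^ 2) ^ C.card := by rw [← mul_pow, div_eq_mul_inv]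
        _ ≤ 2 / (n : ℝ) ^ 2 := pow_le_of_le_one (by positivity) h3 hk)
    have hδ0 : 0 ≤ 2 / (n : ℝ) ^ 2 * ∑ C ∈ smallVertexSets n K, seriesTerm d C := by positivity
    have h := ENNReal.toReal_mono (by finiteness) hlo
    rw [ENNReal.toReal_add (by finiteness) (by finiteness), ENNReal.toReal_add hfin (by finiteness),
      ENNReal.toReal_ofReal hS, ENNReal.toReal_ofReal hT0, ENNReal.toReal_ofReal hδ0] at h
    linarith

end FixedSize

/-! ### Asymptotics -/

section Asymptotics

lemma tendsto_log_natCast_pow_div (k : ℕ) :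
    Tendsto (fun n : ℕ => Real.log n ^ k / n) atTop (𝓝 0) := by
  have h := (Real.isLittleO_pow_log_id_atTop (n := k)).tendsto_div_nhds_zero
  exact h.comp tendsto_natCast_atTop_atTop

lemma tendsto_log_natCast : Tendsto (fun n : ℕ => Real.log n) atTop atTop :=
  Real.tendsto_log_atTop.comp tendsto_natCast_atTop_atTop

/-- The ratio of the expected weight for independent exponential edge weights to the series, in
terms of `ℓ = log n`. -/
lemma expected_exp_div_bounds {n : ℕ} (hn : 2 ≤ n) {α : KEdge n → ℝ} {d : Fin n → ℝ}
    (hα : IsDecomposition α d) (hlog : 1 ≤ Real.log n)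
    (hd : ∀ v, d v ∈ Set.Icc (Real.log n)⁻¹ (Real.log n)) :
    (∫⁻ x, ENNReal.ofReal (mstWeight x) ∂expProduct α).toReal / mstSeries d ≤
      Real.exp (16 * (Real.log n ^ 17 / n)) + 4 * (Real.log n)⁻¹ +
        4 * (Real.log n ^ 4 / n) ∧
    (1 - 2 / (n : ℝ)) * (1 - (∑' k : ℕ, 1 / ((k : ℝ) + 1) ^ 2) * (Real.log n)⁻¹) -
        4 * (Real.log n ^ 5 / n) ≤
      (∫⁻ x, ENNReal.ofReal (mstWeight x) ∂expProduct α).toReal / mstSeries d := by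
  set l := Real.log n with hl
  have hl0 : 0 < l := by linarith
  have hd0 : ∀ v, 0 < d v := fun v => (inv_pos.2 hl0).trans_le (hd v).1
  have hnpos : 0 < n := by omega
  have hn0 : (0 : ℝ) < n := by exact_mod_cast hnpos
  have hn2 : (2 : ℝ) ≤ n := by exact_mod_cast hn
  -- components of up to `log⁶ n` vertices carry the expectation
  set K := ⌈l ^ 6⌉₊ with hKdef
  have hK1 : l ^ 6 ≤ K := Nat.le_ceil _
  have hl6 : 1 ≤ l ^ 6 := one_le_pow₀ hlog
  have hK2 : (K : ℝ) ≤ 2 * l ^ 6 := by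
    have := Nat.ceil_lt_add_one (by positivity : 0 ≤ l ^ 6)
    linarith
  have hK0 : 0 < K := by
    have : (0 : ℝ) < K := by linarith
    exact_mod_cast this
  have hK0' : (0 : ℝ) < K := by exact_mod_cast hK0
  obtain ⟨hup, hlo⟩ := expected_exp_bounds hn hα hlog hd hK0
  rw [← hl] at hup hlo
  have hsum := sum_range_le_mstSeries hnpos hl0 (fun v => (hd v).1) K
  have hadd := mstSeries_le_add hnpos hl0 (fun v => (hd v).1) hK0
  have hinv := inv_sq_le_mstSeries hnpos hl0 hd
  have hS : 0 ≤ ∑ C ∈ smallVertexSets n K, seriesTerm d C :=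
    Finset.sum_nonneg fun C _ => seriesTerm_nonneg hd0 C
  set M := mstSeries d
  set S := ∑ C ∈ smallVertexSets n K, seriesTerm d C
  set E := (∫⁻ x, ENNReal.ofReal (mstWeight x) ∂expProduct α).toReal
  set c := ∑' k : ℕ, 1 / ((k : ℝ) + 1) ^ 2
  have hc0 : 0 ≤ c := tsum_nonneg fun k => by positivity
  have hM0 : 0 < M := lt_of_lt_of_le (by positivity) hinv
  have hM1 : 1 ≤ l ^ 2 * M := by
    rw [inv_le_iff_one_le_mul₀' (by positivity)] at hinv
    exact hinv
  -- an error term `y` is at most `l² y` relative to the series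
  have herr : ∀ y : ℝ, 0 ≤ y → y ≤ l ^ 2 * y * M := fun y hy => by
    nlinarith
  constructor
  · rw [div_le_iff₀ hM0]
    have h1 : Real.exp (4 * l ^ 2 * l / n * (K * l) ^ 2) ≤ Real.exp (16 * (l ^ 17 / n)) := by
      refine Real.exp_le_exp.2 ?_
      calc 4 * l ^ 2 * l / n * (K * l) ^ 2 ≤ 4 * l ^ 2 * l / n * (2 * l ^ 6 * l) ^ 2 := by gcongr
        _ = 16 * (l ^ 17 / n) := by ring
    have h2 : 4 * l ^ 2 * l / n * (n / K) ≤ 4 * l⁻¹ * M := by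
      calc 4 * l ^ 2 * l / n * (n / K) = 4 * l ^ 3 / K := by field_simp
        _ ≤ 4 * l ^ 3 / l ^ 6 := by gcongr
        _ = 4 * (l ^ 3)⁻¹ := by field_simp
        _ ≤ l ^ 2 * (4 * (l ^ 3)⁻¹) * M := herr _ (by positivity)
        _ = 4 * l⁻¹ * M := by field_simp
    have h3 : 4 * l ^ 2 / (n : ℝ) ^ 2 ≤ 4 * (l ^ 4 / n) * M := by
      calc 4 * l ^ 2 / (n : ℝ) ^ 2 ≤ 4 * l ^ 2 / n := by
            refine div_le_div_of_nonneg_left (by positivity) hn0 ?_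
            nlinarith
        _ ≤ l ^ 2 * (4 * l ^ 2 / n) * M := herr _ (by positivity)
        _ = _ := by ring
    have h4 := mul_le_mul h1 hsum hS (Real.exp_pos _).le
    linarith
  · rw [le_div_iff₀ hM0]
    have h1 : 2 / (n : ℝ) ^ 2 ≤ 2 / n := by
      refine div_le_div_of_nonneg_left (by norm_num) hn0 ?_
      nlinarith
    have h2 : l ^ 2 * c / K ≤ c * l⁻¹ * M := by
      calc l ^ 2 * c / K ≤ l ^ 2 * c / l ^ 6 := by gcongr
        _ = c * (l ^ 4)⁻¹ := by field_simp
        _ ≤ l ^ 2 * (c * (l ^ 4)⁻¹) * M := herr _ (by positivity)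
        _ = c * (l ^ 2)⁻¹ * M := by field_simp
        _ ≤ c * l⁻¹ * M := by
          have : l ≤ l ^ 2 := by nlinarith
          gcongr
    have h3 : 4 * l ^ 2 * l / n ≤ 4 * (l ^ 5 / n) * M := by
      calc 4 * l ^ 2 * l / n ≤ l ^ 2 * (4 * l ^ 2 * l / n) * M := herr _ (by positivity)
        _ = _ := by ring
    have h4 : (1 - c * l⁻¹) * M ≤ S := by linarith
    have h5 : 0 ≤ 1 - 2 / (n : ℝ) := by
      rw [sub_nonneg, div_le_one hn0]
      exact hn2
    have h6 := mul_le_mul_of_nonneg_left h4 h5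
    have h7 : (1 - 2 / (n : ℝ)) * S ≤ (1 - 2 / (n : ℝ) ^ 2) * S :=
      mul_le_mul_of_nonneg_right (by linarith) hS
    linarith

lemma tendsto_choose_div_add_one :
    Tendsto (fun n : ℕ => (n.choose 2 : ℝ) / ((n.choose 2 : ℝ) + 1)) atTop (𝓝 1) := by
  refine tendsto_natCast_div_add_atTop (1 : ℝ) |>.comp ?_
  refine tendsto_atTop_mono' atTop ?_ (tendsto_sub_atTop_nat 1)
  filter_upwards [eventually_ge_atTop 2] with n hn
  rw [Nat.choose_two_right]
  calc n - 1 = 2 * (n - 1) / 2 := by omega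
    _ ≤ n * (n - 1) / 2 := Nat.div_le_div_right (Nat.mul_le_mul_right _ hn)

/-- The bounds hold with `log n` in place of the smaller `(log n)^{1/10}`. -/
theorem tendsto_expectedMST_div_mstSeries (α : (n : ℕ) → KEdge n → ℝ) (d : (n : ℕ) → Fin n → ℝ)
    (h : ∀ᶠ n : ℕ in atTop, IsDecomposition (α n) (d n) ∧
        ∀ v : Fin n, d n v ∈
          Set.Icc ((Real.log (n : ℝ) ^ (1 / 10 : ℝ))⁻¹) (Real.log (n : ℝ) ^ (1 / 10 : ℝ))) :
    Tendsto (fun n : ℕ => expectedMST n (α n) / mstSeries (d n)) atTop (𝓝 1) := by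
  have hlog : ∀ᶠ n : ℕ in atTop, 1 ≤ Real.log n := tendsto_log_natCast.eventually_ge_atTop 1
  have hinv : Tendsto (fun n : ℕ => (Real.log n)⁻¹) atTop (𝓝 0) :=
    tendsto_inv_atTop_zero.comp tendsto_log_natCast
  have hmain : ∀ᶠ n : ℕ in atTop, 2 ≤ n ∧ 1 ≤ Real.log n ∧ IsDecomposition (α n) (d n) ∧
      ∀ v, d n v ∈ Set.Icc (Real.log n)⁻¹ (Real.log n) := by
    filter_upwards [h, hlog, eventually_ge_atTop 2] with n hn hl h2
    refine ⟨h2, hl, hn.1, fun v => ?_⟩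
    have hω : Real.log n ^ (1 / 10 : ℝ) ≤ Real.log n := by
      calc Real.log n ^ (1 / 10 : ℝ) ≤ Real.log n ^ (1 : ℝ) :=
            Real.rpow_le_rpow_of_exponent_le hl (by norm_num)
        _ = Real.log n := Real.rpow_one _
    have hω0 : 0 < Real.log n ^ (1 / 10 : ℝ) := Real.rpow_pos_of_pos (by linarith) _
    exact ⟨(inv_anti₀ hω0 hω).trans (hn.2 v).1, (hn.2 v).2.trans hω⟩
  have hratio : Tendsto (fun n : ℕ =>
      (∫⁻ x, ENNReal.ofReal (mstWeight x) ∂expProduct (α n)).toReal / mstSeries (d n))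
      atTop (𝓝 1) := by
    have hU : Tendsto (fun n : ℕ => Real.exp (16 * (Real.log n ^ 17 / n)) + 4 * (Real.log n)⁻¹ +
        4 * (Real.log n ^ 4 / n)) atTop (𝓝 1) := by
      have h1 := (Real.continuous_exp.tendsto _).comp
        ((tendsto_log_natCast_pow_div 17).const_mul 16)
      have h2 := (h1.add (hinv.const_mul 4)).add ((tendsto_log_natCast_pow_div 4).const_mul 4)
      simpa using h2
    have hLo : Tendsto (fun n : ℕ => (1 - 2 / (n : ℝ)) *
        (1 - (∑' k : ℕ, 1 / ((k : ℝ) + 1) ^ 2) * (Real.log n)⁻¹) -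
          4 * (Real.log n ^ 5 / n)) atTop (𝓝 1) := by
      have h1 : Tendsto (fun n : ℕ => 1 - 2 / (n : ℝ)) atTop (𝓝 (1 - 0)) :=
        tendsto_const_nhds.sub (tendsto_const_div_atTop_nhds_zero_nat 2)
      have h2 := (tendsto_const_nhds (x := (1 : ℝ))).sub
        (hinv.const_mul (∑' k : ℕ, 1 / ((k : ℝ) + 1) ^ 2))
      have h3 := (h1.mul h2).sub ((tendsto_log_natCast_pow_div 5).const_mul 4)
      simpa using h3
    refine tendsto_of_tendsto_of_tendsto_of_le_of_le' hLo hU ?_ ?_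
    · filter_upwards [hmain] with n hn
      exact (expected_exp_div_bounds hn.1 hn.2.2.1 hn.2.1 hn.2.2.2).2
    · filter_upwards [hmain] with n hn
      exact (expected_exp_div_bounds hn.1 hn.2.2.1 hn.2.1 hn.2.2.2).1
  have h1 := tendsto_choose_div_add_one.mul hratio
  rw [one_mul] at h1
  refine h1.congr' ?_
  filter_upwards [hmain] with n hn
  have hd0 : ∀ v, 0 < d n v := fun v =>
    (inv_pos.2 (by linarith [hn.2.1])).trans_le (hn.2.2.2 v).1
  rw [expectedMST_eq hn.1 (hn.2.2.1.pos hd0), mul_div_assoc]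

/-! ### The complete graph with identically distributed weights -/

lemma seriesLayer_one {n : ℕ} (k : ℕ) :
    seriesLayer (fun _ : Fin n => (1 : ℝ)) k =
      (n.choose (k + 1) : ℝ) / (n : ℝ) ^ (k + 1) * (k ! / ((k : ℝ) + 1) ^ 2) := by
  unfold seriesLayer
  have h : ∀ C ∈ Finset.powersetCard (k + 1) (Finset.univ : Finset (Fin n)),
      seriesTerm (fun _ : Fin n => (1 : ℝ)) C =
        (k ! : ℝ) / (n : ℝ) ^ (k + 1) * (1 / ((k : ℝ) + 1) ^ 2) := by
    intro C hC
    simp [seriesTerm, (Finset.mem_powersetCard.1 hC).2]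
  rw [Finset.sum_congr rfl h, Finset.sum_const, Finset.card_powersetCard, Finset.card_univ,
    Fintype.card_fin, nsmul_eq_mul]
  ring

theorem tendsto_mstSeries_one :
    Tendsto (fun n : ℕ => mstSeries (fun _ : Fin n => (1 : ℝ))) atTop
      (𝓝 (∑' k : ℕ, 1 / ((k : ℝ) + 1) ^ 3)) := by
  simp_rw [mstSeries_eq_tsum]
  refine tendsto_tsum_of_dominated_convergence summable_one_div_add_one_cube ?_ ?_
  · intro k
    simp_rw [seriesLayer_one]
    have h1 : Tendsto (fun n : ℕ => (n.choose (k + 1) : ℝ) / (n : ℝ) ^ (k + 1)) atTop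
        (𝓝 (1 / (k + 1)!)) := by
      have hequiv := (isEquivalent_choose (k + 1)).div
        (Asymptotics.IsEquivalent.refl (u := fun n : ℕ => (n : ℝ) ^ (k + 1)))
      refine hequiv.symm.tendsto_nhds ?_
      refine tendsto_const_nhds.congr' ?_
      filter_upwards [eventually_gt_atTop 0] with n hn
      have : (n : ℝ) ≠ 0 := by exact_mod_cast hn.ne'
      simp only [Pi.div_apply]
      field_simp
    have h2 := h1.mul_const ((k ! : ℝ) / ((k : ℝ) + 1) ^ 2)
    have h3 : (1 / ((k + 1)! : ℝ)) * ((k ! : ℝ) / ((k : ℝ) + 1) ^ 2) =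
        1 / ((k : ℝ) + 1) ^ 3 := by
      rw [Nat.factorial_succ]
      push_cast
      have : (k ! : ℝ) ≠ 0 := by positivity
      field_simp
    rwa [h3] at h2
  · filter_upwards [eventually_gt_atTop 0] with n hn k
    rw [Real.norm_of_nonneg (seriesLayer_nonneg (fun _ => one_pos) k)]
    simpa using seriesLayer_le hn one_pos (d := fun _ : Fin n => (1 : ℝ)) (fun _ => by simp) k

lemma riemannZeta_three_eq :
    riemannZeta 3 = ((∑' k : ℕ, 1 / ((k : ℝ) + 1) ^ 3 : ℝ) : ℂ) := by
  have h := zeta_eq_tsum_one_div_nat_add_one_cpow (s := 3) (by norm_num)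
  rw [h, Complex.ofReal_tsum]
  refine tsum_congr fun k => ?_
  push_cast
  congr 1
  exact_mod_cast Complex.cpow_natCast ((k : ℂ) + 1) 3

end Asymptotics

/-! ### The asymptotic formula and the limit `ζ(3)` -/

theorem theorem8 :
    (∀ (α : (n : ℕ) → KEdge n → ℝ) (d : (n : ℕ) → Fin n → ℝ),
      (∀ᶠ n : ℕ in atTop, IsDecomposition (α n) (d n) ∧
        ∀ v : Fin n, d n v ∈
          Set.Icc ((Real.log (n : ℝ) ^ (1 / 10 : ℝ))⁻¹) (Real.log (n : ℝ) ^ (1 / 10 : ℝ))) →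
      Tendsto (fun n : ℕ => expectedMST n (α n) / mstSeries (d n)) atTop (𝓝 1)) ∧
    Tendsto (fun n : ℕ => ((mstSeries (fun _ : Fin n => (1 : ℝ)) : ℝ) : ℂ)) atTop
      (𝓝 (riemannZeta 3)) ∧
    Tendsto (fun n : ℕ => ((expectedMST n (fun _ => (1 : ℝ)) : ℝ) : ℂ)) atTop
      (𝓝 (riemannZeta 3)) := by
  refine ⟨tendsto_expectedMST_div_mstSeries, ?_, ?_⟩
  · rw [riemannZeta_three_eq]
    exact (Complex.continuous_ofReal.tendsto _).comp tendsto_mstSeries_one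
  · rw [riemannZeta_three_eq]
    refine (Complex.continuous_ofReal.tendsto _).comp ?_
    have hratio := tendsto_expectedMST_div_mstSeries (fun _ _ => 1) (fun _ _ => 1) (by
      filter_upwards [tendsto_log_natCast.eventually_ge_atTop 1] with n hn
      have hω : 1 ≤ Real.log n ^ (1 / 10 : ℝ) := Real.one_le_rpow hn (by norm_num)
      exact ⟨fun v w h => (one_mul 1).symm, fun v => ⟨inv_le_one_of_one_le₀ hω, hω⟩⟩)
    have h := hratio.mul tendsto_mstSeries_one
    rw [one_mul] at h
    refine h.congr' ?_
    filter_upwards [eventually_gt_atTop 0] with n hn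
    have hpos := inv_sq_le_mstSeries hn one_pos (d := fun _ : Fin n => (1 : ℝ)) (by simp)
    rw [one_pow, inv_one] at hpos
    exact div_mul_cancel₀ _ (by linarith)
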